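/- Let $\mathbb{D}=\{z\in\mathbb{C}:|z|<1\}$ and, for $f$ analytic in $\mathbb{D}$, write $f(z)=\sum_{n\ge 0}\widehat f(n)z^n$. Let $H^\infty$ be the space of analytic functions in $\mathbb{D}$ with $\|f\|_{H^\infty}=\sup_{z\in\mathbb{D}}|f(z)|<\infty$. Let $H^1$, $D^1_0$ and $HL_1$ be the spaces of analytic functions $f$ in $\mathbb{D}$ for which, respectively, $$\|f\|_{H^1}=\sup_{0<r<1}\frac1{2\pi}\int_0^{2\pi}|f(re^{i\theta})|\,d\theta<\infty,$$ $$\|f\|_{D^1_0}=\frac1\pi\int_{\mathbb{D}}|f'(x+iy)|\,dx\,dy+|f(0)|<\infty,$$ $$\|f\|_{HL_1}=\sum_{n=0}^\infty\frac{|\widehat f(n)|}{n+1}<\infty.$$ For $g$ analytic in $\mathbb{D}$ put $T_g(f)(z)=\int_0^z f(\zeta)g'(\zeta)\,d\zeta$, $z\in\mathbb{D}$, and for $X_1\in\{H^1,D^1_0,HL_1\}$ let $\|T_g\|_{X_1\to H^\infty}=\sup\{\|T_g(f)\|_{H^\infty}: f\in X_1,\ \|f\|_{X_1}\le1\}\in[0,\infty]$.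 Let $g\in H^\infty$ be such that $\widehat g(n)\ge0$ for all $n\ge0$, and let $X_1\in\{H^1,D^1_0,HL_1\}$. Then $T_g:X_1\to H^\infty$ is bounded if and only if $$\sup_{k\ge0}\left((k+1)\sum_{n=0}^\infty\frac{(n+1)\widehat g(n+1)}{n+k+1}\right)<\infty.$$ Moreover, there exist absolute constants $0<c\le C<\infty$, independent of $g$, such that $$c\,\sup_{k\ge0}\left((k+1)\sum_{n=0}^\infty\frac{(n+1)\widehat g(n+1)}{n+k+1}\right)\le\|T_g\|_{X_1\to H^\infty}\le C\,\sup_{k\ge0}\left((k+1)\sum_{n=0}^\infty\frac{(n+1)\widehat g(n+1)}{n+k+1}\right).$$ -/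

import Mathlib

open scoped ENNReal NNReal

noncomputable section

/-- The open unit disc of the complex plane. -/
def unitDisc : Set ℂ := Metric.ball 0 1

/-- The `n`-th Maclaurin coefficient of `f`. -/
def maclaurinCoeff (f : ℂ → ℂ) (n : ℕ) : ℂ := iteratedDeriv n f 0 / (n.factorial : ℂ)

/-- The supremum norm over the unit disc (norm of the Hardy space `H^∞`), possibly infinite. -/
def hInftyNorm (f : ℂ → ℂ) : ℝ≥0∞ := ⨆ z ∈ unitDisc, ‖f z‖ₑ

/-- The integral mean `M_1(r, f) = (1 / 2π) ∫_0^{2π} |f(r e^{iθ})| dθ`. -/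
def integralMeanOne (r : ℝ) (f : ℂ → ℂ) : ℝ≥0∞ :=
  ENNReal.ofReal (1 / (2 * Real.pi)) *
    ∫⁻ θ in Set.Ioc (0 : ℝ) (2 * Real.pi), ‖f (circleMap 0 r θ)‖ₑ

/-- The norm of the Hardy space `H^1`, possibly infinite. -/
def hardyOneNorm (f : ℂ → ℂ) : ℝ≥0∞ := ⨆ r ∈ Set.Ioo (0 : ℝ) 1, integralMeanOne r f

/-- The norm of the Dirichlet-type space `D^1_0`, possibly infinite:
`∫_𝔻 |f'| dA + |f 0|`, with `dA = dx dy / π`. -/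
def dirichletOneNorm (f : ℂ → ℂ) : ℝ≥0∞ :=
  ENNReal.ofReal (1 / Real.pi) * (∫⁻ z in unitDisc, ‖deriv f z‖ₑ) + ‖f 0‖ₑ

/-- The norm of the Hardy-Littlewood space `HL_1`, possibly infinite:
`∑ |f̂(n)| (n + 1)⁻¹`. -/
def hardyLittlewoodOneNorm (f : ℂ → ℂ) : ℝ≥0∞ :=
  ∑' n : ℕ, ‖maclaurinCoeff f n‖ₑ * ((n : ℝ≥0∞) + 1)⁻¹

/-- The functions analytic in the unit disc whose norm `N` is finite. Values off the disc are
irrelevant. -/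
def analyticSpace (N : (ℂ → ℂ) → ℝ≥0∞) : Set (ℂ → ℂ) :=
  {f | DifferentiableOn ℂ f unitDisc ∧ N f < ∞}

/-- The integral operator `T_g f (z) = ∫_0^z f(ζ) g'(ζ) dζ`, along the segment from `0` to `z`. -/
def integralOp (g f : ℂ → ℂ) (z : ℂ) : ℂ :=
  ∫ t in (0 : ℝ)..1, f (t * z) * deriv g (t * z) * z

/-- `T_g` is a bounded operator into `H^∞` from the space of analytic functions with finite
norm `N`. -/
def IsBoundedIntegralOp (N : (ℂ → ℂ) → ℝ≥0∞) (g : ℂ → ℂ) : Prop :=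
  ∃ C : ℝ≥0, ∀ f ∈ analyticSpace N,
    integralOp g f ∈ analyticSpace hInftyNorm ∧ hInftyNorm (integralOp g f) ≤ C * N f

/-- The operator norm of `T_g` into `H^∞` from the space of analytic functions with finite
norm `N`; it is `∞` if `T_g` is unbounded. -/
def integralOpNorm (N : (ℂ → ℂ) → ℝ≥0∞) (g : ℂ → ℂ) : ℝ≥0∞ :=
  ⨆ f ∈ {f | f ∈ analyticSpace N ∧ N f ≤ 1}, hInftyNorm (integralOp g f)

/-- `sup_k (k + 1) ∑_n (n + 1) ĝ(n + 1) / (n + k + 1)` for a function `g` with non-negative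
Maclaurin coefficients, possibly infinite. -/
def coeffSup (g : ℂ → ℂ) : ℝ≥0∞ :=
  ⨆ k : ℕ, ((k : ℝ≥0∞) + 1) *
    ∑' n : ℕ, ENNReal.ofReal
      (((n : ℝ) + 1) * (maclaurinCoeff g (n + 1)).re / ((n : ℝ) + (k : ℝ) + 1))

end

/-! ### The Fejér–Riesz inequality -/

section FejerRiesz

open Complex MeasureTheory Filter Topology ComplexConjugate

/-! Since `(k + 1) / (n + k + 1)` increases to `1` with `k`, the supremum in the statement is just
`S = ∑ (n + 1) ĝ(n + 1)`, the sum of the coefficients of `g'` (`coeffSup_eq_derivCoeffSum`). As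
these are non-negative, `|g'| ≤ S` in the disc, and `g'` increases to `S` along `[0, 1)`. The
theorem thus says that `‖T_g‖` is comparable to `sup |g'|`, with constants `1/18` and `π` serving
all three spaces.

Upper estimate: `|T_g f(z)|` is at most `S` times the integral of `|f|` over the segment from `0` to
`z`, and each of the three norms controls this integral up to the factor `π`. For `H^1` this is the
Fejér–Riesz inequality, for `D^1_0` Fejér–Riesz applied to `f'` at every radius and then integrated,
and for `HL_1` termwise integration of the power series.

Lower estimate: the kernels `(1 - r²) / (9 (1 - r z)²)` lie in the unit ball of each space. Given `y
< 1`, some `r > y` makes the kernel have integral `1/18` over `[y, r]`. Evaluating `T_g` of it at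
`r` and using the monotonicity of `g'` gives at least `g'(y) / 18`; then `y → 1`.

Fejér–Riesz is proved for squares by Cauchy's theorem, then for polynomials by a factorization into
two factors of balanced size, and then for analytic functions by uniform approximation. -/

theorem circleMap_mem_unitBall {ρ : ℝ} (h0 : 0 ≤ ρ) (h1 : ρ < 1) (θ : ℝ) :
    circleMap 0 ρ θ ∈ Metric.ball (0 : ℂ) 1 := by
  simpa [abs_of_nonneg h0] using h1

theorem ofReal_mem_unitBall {ρ t : ℝ} (h1 : ρ < 1) (ht : t ∈ Set.Icc (-ρ) ρ) :
    (t : ℂ) ∈ Metric.ball (0 : ℂ) 1 := by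
  have : |t| ≤ ρ := abs_le.2 ht
  simpa using this.trans_lt h1

/-- On a disc, integrals of an analytic function over a diameter and over a half circle agree. -/
theorem integral_diameter_eq_integral_halfCircle {Q : ℂ → ℂ}
    (hQ : DifferentiableOn ℂ Q (Metric.ball 0 1)) {ρ : ℝ} (h0 : 0 ≤ ρ) (h1 : ρ < 1) :
    ∫ t in (-ρ)..ρ, Q t = -∫ θ in (0 : ℝ)..Real.pi, deriv (circleMap 0 ρ) θ * Q (circleMap 0 ρ θ) := by
  obtain ⟨A, hA⟩ := hQ.isExactOn_ball
  have hneg : -ρ ≤ ρ := by linarith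
  have e1 : ∫ t in (-ρ)..ρ, Q t = A ρ - A (-ρ : ℝ) := by
    apply intervalIntegral.integral_eq_sub_of_hasDerivAt (f := fun t : ℝ => A t)
    · intro t ht
      rw [Set.uIcc_of_le hneg] at ht
      exact (hA t (ofReal_mem_unitBall h1 ht)).comp_ofReal
    · apply ContinuousOn.intervalIntegrable
      rw [Set.uIcc_of_le hneg]
      exact hQ.continuousOn.comp continuous_ofReal.continuousOn
        fun t ht => ofReal_mem_unitBall h1 ht
  have e2 : ∫ θ in (0 : ℝ)..Real.pi, deriv (circleMap 0 ρ) θ * Q (circleMap 0 ρ θ) =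
      A (circleMap 0 ρ Real.pi) - A (circleMap 0 ρ 0) := by
    apply intervalIntegral.integral_eq_sub_of_hasDerivAt (f := fun t : ℝ => A (circleMap 0 ρ t))
    · intro t _
      have := (hA _ (circleMap_mem_unitBall h0 h1 t)).comp t (hasDerivAt_circleMap 0 ρ t)
      rw [deriv_circleMap, mul_comm]
      exact this
    · apply Continuous.intervalIntegrable
      simp only [deriv_circleMap]
      exact ((continuous_circleMap 0 ρ).mul continuous_const).mul
        (hQ.continuousOn.comp_continuous (continuous_circleMap 0 ρ)
          (circleMap_mem_unitBall h0 h1))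
  rw [e1, e2]
  simp [circleMap]

/-- The function `F(z) conj(F(conj z))` is analytic and equals `|F|²` on the real axis, so the
diameter can be deformed to the upper half circle. There `|F(z)| |F(conj z)|` is at most half the
sum of the squares, and the conjugate term supplies the lower half circle. -/
theorem fejerRiesz_sq {F : ℂ → ℂ} (hF : DifferentiableOn ℂ F (Metric.ball 0 1))
    {ρ : ℝ} (h0 : 0 ≤ ρ) (h1 : ρ < 1) :
    ∫ t in (0 : ℝ)..ρ, ‖F t‖ ^ 2 ≤
      ρ / 2 * ∫ θ in (-Real.pi)..Real.pi, ‖F (circleMap 0 ρ θ)‖ ^ 2 := by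
  have hball : ∀ z : ℂ, z ∈ Metric.ball (0 : ℂ) 1 → conj z ∈ Metric.ball (0 : ℂ) 1 := by
    intro z hz; simpa using hz
  have hQ : DifferentiableOn ℂ (fun z => F z * conj (F (conj z))) (Metric.ball 0 1) := by
    intro z hz
    have hd : DifferentiableAt ℂ F z := hF.differentiableAt (Metric.isOpen_ball.mem_nhds hz)
    have hd' : DifferentiableAt ℂ F (conj z) :=
      hF.differentiableAt (Metric.isOpen_ball.mem_nhds (hball z hz))
    have := hd'.conj_conj
    rw [Complex.conj_conj] at this
    exact (hd.mul this).differentiableWithinAt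
  have key := integral_diameter_eq_integral_halfCircle hQ h0 h1
  have hneg : -ρ ≤ ρ := by linarith
  have hcF : Continuous fun θ : ℝ => F (circleMap 0 ρ θ) :=
    hF.continuousOn.comp_continuous (continuous_circleMap 0 ρ) (circleMap_mem_unitBall h0 h1)
  have hcR : ContinuousOn (fun t : ℝ => ‖F t‖ ^ 2) (Set.Icc (-ρ) ρ) :=
    ((hF.continuousOn.comp continuous_ofReal.continuousOn
      fun t ht => ofReal_mem_unitBall h1 ht).norm).pow 2
  have hl : ∫ t in (-ρ)..ρ, F t * conj (F (conj (t : ℂ))) =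
      ((∫ t in (-ρ)..ρ, ‖F t‖ ^ 2 : ℝ) : ℂ) := by
    rw [← intervalIntegral.integral_ofReal]
    congr 1; ext t
    rw [conj_ofReal, mul_conj, normSq_eq_norm_sq]
  have hconj : ∀ θ : ℝ, conj (circleMap 0 ρ θ) = circleMap 0 ρ (-θ) := by
    intro θ
    simp [circleMap, ← exp_conj]
  have hpi := Real.pi_pos.le
  calc ∫ t in (0 : ℝ)..ρ, ‖F t‖ ^ 2 ≤ ∫ t in (-ρ)..ρ, ‖F t‖ ^ 2 := by
        apply intervalIntegral.integral_mono_interval (by linarith) h0 le_rfl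
        · exact Eventually.of_forall fun t => by positivity
        · apply ContinuousOn.intervalIntegrable
          rwa [Set.uIcc_of_le hneg]
    _ = ‖((∫ t in (-ρ)..ρ, ‖F t‖ ^ 2 : ℝ) : ℂ)‖ := by
        rw [norm_real, Real.norm_of_nonneg]
        exact intervalIntegral.integral_nonneg hneg fun t _ => by positivity
    _ = ‖∫ θ in (0 : ℝ)..Real.pi, deriv (circleMap 0 ρ) θ *
          (F (circleMap 0 ρ θ) * conj (F (conj (circleMap 0 ρ θ))))‖ := by
        rw [← hl, key, norm_neg]
    _ ≤ ∫ θ in (0 : ℝ)..Real.pi,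
          (ρ / 2 * ‖F (circleMap 0 ρ θ)‖ ^ 2 + ρ / 2 * ‖F (circleMap 0 ρ (-θ))‖ ^ 2) := by
        apply intervalIntegral.norm_integral_le_of_norm_le hpi
        · refine Eventually.of_forall fun θ _ => ?_
          rw [hconj]
          simp only [deriv_circleMap, norm_mul, norm_circleMap_zero, norm_I, RCLike.norm_conj,
            abs_of_nonneg h0]
          nlinarith [mul_nonneg h0 (sq_nonneg (‖F (circleMap 0 ρ θ)‖ - ‖F (circleMap 0 ρ (-θ))‖))]
        · apply Continuous.intervalIntegrable
          have := hcF.comp continuous_neg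
          exact (continuous_const.mul (hcF.norm.pow 2)).add
            (continuous_const.mul (this.norm.pow 2))
    _ = ρ / 2 * ∫ θ in (-Real.pi)..Real.pi, ‖F (circleMap 0 ρ θ)‖ ^ 2 := by
        have hi : ∀ a b, IntervalIntegrable (fun θ : ℝ => ‖F (circleMap 0 ρ θ)‖ ^ 2) volume a b :=
          fun a b => (hcF.norm.pow 2).intervalIntegrable a b
        have hi' : IntervalIntegrable (fun θ : ℝ => ‖F (circleMap 0 ρ (-θ))‖ ^ 2) volume
            0 Real.pi := (((hcF.comp continuous_neg)).norm.pow 2).intervalIntegrable _ _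
        rw [intervalIntegral.integral_add ((hi _ _).const_mul _) (hi'.const_mul _),
          intervalIntegral.integral_const_mul, intervalIntegral.integral_const_mul,
          intervalIntegral.integral_comp_neg (fun θ : ℝ => ‖F (circleMap 0 ρ θ)‖ ^ 2),
          ← intervalIntegral.integral_add_adjacent_intervals (hi (-Real.pi) 0) (hi 0 Real.pi)]
        simp only [neg_zero]
        ring

/-- A polynomial is, in the unit disc, a product of two analytic functions whose squares are
dominated by a polynomial of the same modulus on the unit circle. -/
theorem exists_balanced_factorization (P : Polynomial ℂ) :
    ∃ (p q : ℂ → ℂ) (M : Polynomial ℂ), DifferentiableOn ℂ p (Metric.ball 0 1) ∧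
      DifferentiableOn ℂ q (Metric.ball 0 1) ∧
      (∀ z ∈ Metric.ball (0 : ℂ) 1, P.eval z = p z * q z ∧ ‖p z‖ ^ 2 ≤ ‖M.eval z‖ ∧
        ‖q z‖ ^ 2 ≤ ‖M.eval z‖) ∧ ∀ z : ℂ, ‖z‖ = 1 → ‖M.eval z‖ = ‖P.eval z‖ := by
  have hsqrt : ∀ b : ℂ, ‖b‖ ≤ 1 → ∃ s : ℂ → ℂ, DifferentiableOn ℂ s (Metric.ball 0 1) ∧
      ∀ z ∈ Metric.ball (0 : ℂ) 1, s z ^ 2 = 1 - b * z ∧ s z ≠ 0 := by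
    intro b hb
    have hre : ∀ z ∈ Metric.ball (0 : ℂ) 1, 0 < (1 - b * z).re := by
      intro z hz
      have hz' : ‖z‖ < 1 := by simpa using hz
      have : (b * z).re < 1 := (re_le_norm _).trans_lt (by
        rw [norm_mul]; nlinarith [norm_nonneg z, norm_nonneg b])
      simpa using this
    have hne : ∀ z ∈ Metric.ball (0 : ℂ) 1, 1 - b * z ≠ 0 := fun z hz h => by
      have := hre z hz; rw [h] at this; simp at this
    -- The principal branch is analytic here because `1 - b z` stays in the right half plane.
    refine ⟨fun z => (1 - b * z) ^ (1 / 2 : ℂ), ?_, ?_⟩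
    · intro z hz
      refine DifferentiableAt.differentiableWithinAt ?_
      refine DifferentiableAt.cpow (by fun_prop) (by fun_prop) (Or.inl (hre z hz))
    · intro z hz
      refine ⟨?_, by simp [cpow_eq_zero_iff, hne z hz]⟩
      have := cpow_nat_inv_pow (1 - b * z) (n := 2) two_ne_zero
      simpa only [one_div, Nat.cast_ofNat] using this
  have hroot : ∀ a : ℂ, ∃ c : ℂ, c ^ 2 = a := fun a => IsAlgClosed.exists_pow_nat_eq a two_pos
  -- The property is multiplicative, and a split polynomial is a product of constants and factors `X
  -- + C a`, so it suffices to treat these.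
  refine Submonoid.closure_induction
    (motive := fun (P : Polynomial ℂ) _ => ∃ (p q : ℂ → ℂ) (M : Polynomial ℂ),
      DifferentiableOn ℂ p (Metric.ball 0 1) ∧ DifferentiableOn ℂ q (Metric.ball 0 1) ∧
      (∀ z ∈ Metric.ball (0 : ℂ) 1, P.eval z = p z * q z ∧ ‖p z‖ ^ 2 ≤ ‖M.eval z‖ ∧
        ‖q z‖ ^ 2 ≤ ‖M.eval z‖) ∧ ∀ z : ℂ, ‖z‖ = 1 → ‖M.eval z‖ = ‖P.eval z‖)
    ?_ ?_ ?_ (IsAlgClosed.splits P)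
  · rintro _ (⟨a, rfl⟩ | ⟨a, rfl⟩)
    · obtain ⟨c, hc⟩ := hroot a
      refine ⟨fun _ => c, fun _ => c, Polynomial.C a, by fun_prop, by fun_prop, ?_, ?_⟩
      · intro z _
        simp [← hc, sq]
      · simp
    · rcases lt_or_ge ‖a‖ 1 with ha | ha
      -- The zero `-a` lies inside the disc. Reflecting it gives `1 + conj(a) z`, with no zero
      -- there, and the Blaschke factor `(z + a) / (1 + conj(a) z)` has modulus at most `1` in the
      -- disc and `1` on the circle. The balanced factors are `q = s` and `p = (z + a) / s`, with
      -- `s² = 1 + conj(a) z`.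
      · obtain ⟨s, hs, hs2⟩ := hsqrt (-conj a) (by simpa using ha.le)
        have heval : ∀ z : ℂ, (1 + Polynomial.C (conj a) * Polynomial.X : Polynomial ℂ).eval z =
          1 + conj a * z := by intro z; simp
        have hsq : ∀ z : ℂ, ‖1 + conj a * z‖ ^ 2 - ‖z + a‖ ^ 2 =
            (1 - ‖a‖ ^ 2) * (1 - ‖z‖ ^ 2) := by
          intro z
          simp only [← normSq_eq_norm_sq, normSq_apply, add_re, add_im, mul_re, mul_im, conj_re,
            conj_im, one_re, one_im]
          ring
        refine ⟨fun z => (z + a) / s z, s, 1 + Polynomial.C (conj a) * Polynomial.X,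
          ?_, hs, ?_, ?_⟩
        · exact DifferentiableOn.div (by fun_prop) hs fun z hz => (hs2 z hz).2
        · intro z hz
          have hz' : ‖z‖ < 1 := by simpa using hz
          obtain ⟨h2, hne⟩ := hs2 z hz
          have h3 : s z ^ 2 = 1 + conj a * z := by rw [h2]; ring
          have h4 : ‖s z‖ ^ 2 = ‖1 + conj a * z‖ := by rw [← norm_pow, h3]
          have h5 : 0 < ‖s z‖ ^ 2 := by positivity
          rw [heval]
          refine ⟨by simp [div_mul_cancel₀ _ hne], ?_, h4.le⟩
          rw [norm_div, div_pow, h4, div_le_iff₀ (h4 ▸ h5), ← sq]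
          have := hsq z
          have h6 : 0 ≤ (1 - ‖a‖ ^ 2) * (1 - ‖z‖ ^ 2) := by
            apply mul_nonneg <;> nlinarith [norm_nonneg a, norm_nonneg z]
          linarith
        · intro z hz
          have := hsq z
          rw [hz] at this
          rw [heval]
          simp only [Polynomial.eval_add, Polynomial.eval_X, Polynomial.eval_C]
          refine (sq_eq_sq₀ (norm_nonneg _) (norm_nonneg _)).1 (by linarith)
      -- The factor has no zero in the open disc, so it has an analytic square root, taken for both
      -- `p` and `q`.
      · obtain ⟨s, hs, hs2⟩ := hsqrt (-a⁻¹) (by simpa using inv_le_one_of_one_le₀ ha)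
        obtain ⟨c, hc⟩ := hroot a
        have ha0 : a ≠ 0 := norm_pos_iff.1 (by linarith)
        have h3 : ∀ z ∈ Metric.ball (0 : ℂ) 1, z + a = (c * s z) ^ 2 := by
          intro z hz
          rw [mul_pow, hc, (hs2 z hz).1]
          field_simp
          ring
        refine ⟨fun z => c * s z, fun z => c * s z, Polynomial.X + Polynomial.C a,
          hs.const_mul c, hs.const_mul c, ?_, fun _ _ => rfl⟩
        intro z hz
        simp only [Polynomial.eval_add, Polynomial.eval_X, Polynomial.eval_C, h3 z hz, norm_pow]
        exact ⟨sq _, le_rfl, le_rfl⟩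
  · exact ⟨fun _ => 1, fun _ => 1, 1, by fun_prop, by fun_prop, by simp, by simp⟩
  · rintro P Q - - ⟨p, q, M, hp, hq, h, hM⟩ ⟨p', q', M', hp', hq', h', hM'⟩
    refine ⟨p * p', q * q', M * M', hp.mul hp', hq.mul hq', ?_, ?_⟩
    · intro z hz
      obtain ⟨h1, h2, h3⟩ := h z hz
      obtain ⟨h1', h2', h3'⟩ := h' z hz
      simp only [Polynomial.eval_mul, Pi.mul_apply, norm_mul, mul_pow]
      refine ⟨by rw [h1, h1']; ring, by gcongr, by gcongr⟩
    · intro z hz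
      simp [hM z hz, hM' z hz]

/-- Write `|P| = |p| |q| ≤ (|p|² + |q|²) / 2` and apply the squared inequality to each factor at
radius `ρ < 1`. Dominating both squares by `|M|` before letting `ρ → 1` avoids any boundary values
of `p` and `q`: `M` is continuous up to the circle, where `|M| = |P|`. -/
theorem fejerRiesz_polynomial (P : Polynomial ℂ) :
    ∫ t in (0 : ℝ)..1, ‖P.eval (t : ℂ)‖ ≤
      1 / 2 * ∫ θ in (-Real.pi)..Real.pi, ‖P.eval (circleMap 0 1 θ)‖ := by
  obtain ⟨p, q, M, hp, hq, h, hM⟩ := exists_balanced_factorization P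
  have hpi := Real.pi_pos.le
  have hcP : Continuous fun t : ℝ => ‖P.eval (t : ℂ)‖ := (P.continuous.comp continuous_ofReal).norm
  have hcM : Continuous fun x : ℝ × ℝ => ‖M.eval (circleMap 0 x.1 x.2)‖ := by
    refine (M.continuous.comp ?_).norm
    unfold circleMap
    fun_prop
  have hbound : ∀ ρ ∈ Set.Ico (0 : ℝ) 1, ∫ t in (0 : ℝ)..ρ, ‖P.eval (t : ℂ)‖ ≤
      ρ / 2 * ∫ θ in (-Real.pi)..Real.pi, ‖M.eval (circleMap 0 ρ θ)‖ := by
    rintro ρ ⟨h0, h1⟩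
    have hmem : ∀ t ∈ Set.Icc 0 ρ, (t : ℂ) ∈ Metric.ball (0 : ℂ) 1 := fun t ht =>
      ofReal_mem_unitBall h1 ⟨by linarith [ht.1], ht.2⟩
    have hint : ∀ F : ℂ → ℂ, DifferentiableOn ℂ F (Metric.ball 0 1) →
        IntervalIntegrable (fun t : ℝ => 1 / 2 * ‖F t‖ ^ 2) volume 0 ρ := by
      intro F hF
      apply ContinuousOn.intervalIntegrable
      rw [Set.uIcc_of_le h0]
      exact continuousOn_const.mul
        ((hF.continuousOn.comp continuous_ofReal.continuousOn hmem).norm.pow 2)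
    have hle : ∀ F : ℂ → ℂ, DifferentiableOn ℂ F (Metric.ball 0 1) →
        (∀ z ∈ Metric.ball (0 : ℂ) 1, ‖F z‖ ^ 2 ≤ ‖M.eval z‖) →
        ∫ t in (0 : ℝ)..ρ, 1 / 2 * ‖F t‖ ^ 2 ≤
          ρ / 4 * ∫ θ in (-Real.pi)..Real.pi, ‖M.eval (circleMap 0 ρ θ)‖ := by
      intro F hF hFM
      have hcF : Continuous fun θ : ℝ => F (circleMap 0 ρ θ) :=
        hF.continuousOn.comp_continuous (continuous_circleMap 0 ρ)
          (circleMap_mem_unitBall h0 h1)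
      have h2 : ∫ θ in (-Real.pi)..Real.pi, ‖F (circleMap 0 ρ θ)‖ ^ 2 ≤
          ∫ θ in (-Real.pi)..Real.pi, ‖M.eval (circleMap 0 ρ θ)‖ := by
        apply intervalIntegral.integral_mono_on (by linarith)
        · exact (hcF.norm.pow 2).intervalIntegrable _ _
        · exact (M.continuous.comp (continuous_circleMap 0 ρ)).norm.intervalIntegrable _ _
        · exact fun θ _ => hFM _ (circleMap_mem_unitBall h0 h1 θ)
      rw [intervalIntegral.integral_const_mul]
      have := fejerRiesz_sq hF h0 h1
      have := mul_le_mul_of_nonneg_left h2 (by linarith : 0 ≤ ρ / 2)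
      linarith
    calc ∫ t in (0 : ℝ)..ρ, ‖P.eval (t : ℂ)‖
        ≤ ∫ t in (0 : ℝ)..ρ, (1 / 2 * ‖p t‖ ^ 2 + 1 / 2 * ‖q t‖ ^ 2) := by
          apply intervalIntegral.integral_mono_on h0 (hcP.intervalIntegrable _ _)
            ((hint p hp).add (hint q hq))
          intro t ht
          rw [(h t (hmem t ht)).1, norm_mul]
          nlinarith [sq_nonneg (‖p t‖ - ‖q t‖)]
      _ ≤ _ := by
          rw [intervalIntegral.integral_add (hint p hp) (hint q hq)]
          have := hle p hp fun z hz => (h z hz).2.1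
          have := hle q hq fun z hz => (h z hz).2.2
          linarith
  have hlim1 : Tendsto (fun ρ : ℝ => ∫ t in (0 : ℝ)..ρ, ‖P.eval (t : ℂ)‖) (𝓝[<] 1)
      (𝓝 (∫ t in (0 : ℝ)..1, ‖P.eval (t : ℂ)‖)) :=
    ((intervalIntegral.continuous_primitive (fun a b => hcP.intervalIntegrable a b) 0).tendsto
      1).mono_left nhdsWithin_le_nhds
  have hlim2 : Tendsto
      (fun ρ : ℝ => ρ / 2 * ∫ θ in (-Real.pi)..Real.pi, ‖M.eval (circleMap 0 ρ θ)‖) (𝓝[<] 1)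
      (𝓝 (1 / 2 * ∫ θ in (-Real.pi)..Real.pi, ‖M.eval (circleMap 0 1 θ)‖)) := by
    have : Continuous fun ρ : ℝ => ρ / 2 *
        ∫ θ in (-Real.pi)..Real.pi, ‖M.eval (circleMap 0 ρ θ)‖ :=
      (continuous_id.div_const 2).mul
        (intervalIntegral.continuous_parametric_intervalIntegral_of_continuous' hcM _ _)
    exact (this.tendsto 1).mono_left nhdsWithin_le_nhds
  have hfin : ∫ θ in (-Real.pi)..Real.pi, ‖M.eval (circleMap 0 1 θ)‖ =
      ∫ θ in (-Real.pi)..Real.pi, ‖P.eval (circleMap 0 1 θ)‖ := by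
    congr 1; ext θ
    exact hM _ (by simp)
  rw [← hfin]
  refine le_of_tendsto_of_tendsto hlim1 hlim2 ?_
  filter_upwards [Ico_mem_nhdsLT (show (0 : ℝ) < 1 by norm_num)] with ρ hρ using hbound ρ hρ

/-- **Fejér–Riesz inequality**, for the exponent one. -/
theorem fejerRiesz {f : ℂ → ℂ} (hf : DifferentiableOn ℂ f (Metric.ball 0 1)) {z : ℂ}
    (hz : z ∈ Metric.ball (0 : ℂ) 1) :
    ∫ t in (0 : ℝ)..1, ‖f (t * z)‖ ≤
      1 / 2 * ∫ θ in (-Real.pi)..Real.pi, ‖f (circleMap 0 ‖z‖ θ)‖ := by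
  have hz' : ‖z‖ < 1 := by simpa using hz
  have hpi := Real.pi_pos.le
  have hmem : ∀ w : ℂ, ‖w‖ ≤ 1 → w * z ∈ Metric.ball (0 : ℂ) 1 := by
    intro w hw
    simp only [mem_ball_zero_iff, norm_mul]
    nlinarith [norm_nonneg z]
  -- By rotation invariance both sides become integrals of `w ↦ f(w z)`, over the radius `[0, 1]`
  -- and the unit circle. This function is analytic past the closed disc because `‖z‖ < 1`.
  have hrot : ∫ θ in (-Real.pi)..Real.pi, ‖f (circleMap 0 ‖z‖ θ)‖ =
      ∫ θ in (-Real.pi)..Real.pi, ‖f (circleMap 0 1 θ * z)‖ := by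
    have hper : Function.Periodic (fun θ : ℝ => ‖f (circleMap 0 ‖z‖ θ)‖) (2 * Real.pi) := by
      intro θ
      simp only [periodic_circleMap 0 ‖z‖ θ]
    have e : ∀ θ : ℝ, circleMap 0 1 θ * z = circleMap 0 ‖z‖ (θ + arg z) := by
      intro θ
      simp only [circleMap, ofReal_add, add_mul, exp_add, ofReal_one]
      linear_combination -(exp (θ * I)) * norm_mul_exp_arg_mul_I z
    simp only [e]
    rw [intervalIntegral.integral_comp_add_right (fun θ : ℝ => ‖f (circleMap 0 ‖z‖ θ)‖)]
    have := hper.intervalIntegral_add_eq (-Real.pi) (-Real.pi + arg z)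
    convert this using 2 <;> ring
  rw [hrot]
  have hcf : Continuous fun θ : ℝ => f (circleMap 0 1 θ * z) :=
    hf.continuousOn.comp_continuous ((continuous_circleMap 0 1).mul continuous_const)
      fun θ => hmem _ (by simp)
  have hcr : ContinuousOn (fun t : ℝ => f (t * z)) (Set.uIcc 0 1) := by
    rw [Set.uIcc_of_le zero_le_one]
    refine hf.continuousOn.comp (by fun_prop) fun t ht => hmem _ ?_
    rw [norm_real, Real.norm_of_nonneg ht.1]
    exact ht.2
  have happrox : ∀ ε > 0, ∃ P : Polynomial ℂ, ∀ w : ℂ, ‖w‖ ≤ 1 →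
      ‖f (w * z) - P.eval w‖ ≤ ε := by
    -- The polynomial is a Taylor partial sum of `f`, which converges uniformly on a disc of radius
    -- `R'` with `‖z‖ < R' < R < 1`.
    intro ε hε
    obtain ⟨R, hzR, hR1⟩ := exists_between hz'
    have hR0 : 0 < R := (norm_nonneg z).trans_lt hzR
    lift R to ℝ≥0 using hR0.le
    have hps := (hf.mono (Metric.closedBall_subset_ball hR1)).hasFPowerSeriesOnBall
      (by exact_mod_cast hR0)
    obtain ⟨R', hzR', hR'⟩ := exists_between hzR
    lift R' to ℝ≥0 using (norm_nonneg z).trans hzR'.le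
    have hu := hps.tendstoUniformlyOn' (r' := R') (by exact_mod_cast hR')
    obtain ⟨n, hn⟩ := (Metric.tendstoUniformlyOn_iff.1 hu ε hε).exists
    refine ⟨∑ k ∈ Finset.range n,
      Polynomial.C (z ^ k * (cauchyPowerSeries f 0 R).coeff k) * Polynomial.X ^ k, fun w hw => ?_⟩
    have := hn (w * z) (by
      simp only [mem_ball_zero_iff, norm_mul]
      nlinarith [norm_nonneg z])
    rw [dist_eq_norm] at this
    refine le_of_eq_of_le ?_ this.le
    congr 2
    simp only [FormalMultilinearSeries.partialSum, Polynomial.eval_finsetSum, sub_zero]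
    refine Finset.sum_congr rfl fun k _ => ?_
    rw [FormalMultilinearSeries.apply_eq_pow_smul_coeff]
    simp [mul_pow]
    ring
  refine le_of_forall_pos_le_add fun ε hε => ?_
  -- The approximation error `δ` costs `δ` on the radius and `(1/2) · 2π δ` on the circle, in total
  -- `(1 + π) δ = ε`.
  obtain ⟨P, hP⟩ := happrox (ε / (1 + Real.pi)) (by positivity)
  set δ := ε / (1 + Real.pi) with hδ
  have h1 : ∫ t in (0 : ℝ)..1, ‖f (t * z)‖ ≤ ∫ t in (0 : ℝ)..1, (‖P.eval (t : ℂ)‖ + δ) := by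
    have hc : Continuous fun t : ℝ => ‖P.eval (t : ℂ)‖ + δ :=
      (P.continuous.comp continuous_ofReal).norm.add continuous_const
    refine intervalIntegral.integral_mono_on zero_le_one hcr.norm.intervalIntegrable
      (hc.intervalIntegrable _ _) fun t ht => ?_
    have := hP t (by rw [norm_real, Real.norm_of_nonneg ht.1]; exact ht.2)
    linarith [norm_sub_norm_le (f (t * z)) (P.eval (t : ℂ))]
  have h2 : ∫ θ in (-Real.pi)..Real.pi, ‖P.eval (circleMap 0 1 θ)‖ ≤
      ∫ θ in (-Real.pi)..Real.pi, (‖f (circleMap 0 1 θ * z)‖ + δ) := by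
    refine intervalIntegral.integral_mono_on (by linarith)
      ((P.continuous.comp (continuous_circleMap 0 1)).norm.intervalIntegrable _ _)
      ((hcf.norm.add continuous_const).intervalIntegrable _ _) fun θ _ => ?_
    have := hP (circleMap 0 1 θ) (by simp)
    linarith [norm_sub_norm_le (P.eval (circleMap 0 1 θ)) (f (circleMap 0 1 θ * z)),
      norm_sub_rev (P.eval (circleMap 0 1 θ)) (f (circleMap 0 1 θ * z))]
  have hcP : Continuous fun t : ℝ => ‖P.eval (t : ℂ)‖ :=
    (P.continuous.comp continuous_ofReal).norm
  rw [intervalIntegral.integral_add (hcP.intervalIntegrable _ _) (by simp)] at h1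
  rw [intervalIntegral.integral_add (hcf.norm.intervalIntegrable _ _) (by simp)] at h2
  simp only [intervalIntegral.integral_const, smul_eq_mul] at h1 h2
  have h3 := fejerRiesz_polynomial P
  have h4 : δ * (1 + Real.pi) = ε := by rw [hδ]; field_simp
  linarith

end FejerRiesz

/-! ### Maclaurin coefficients -/

section Coefficients

open MeasureTheory Filter Topology

theorem hasSum_maclaurinCoeff {f : ℂ → ℂ} (hf : DifferentiableOn ℂ f unitDisc) {z : ℂ}
    (hz : z ∈ unitDisc) : HasSum (fun n => maclaurinCoeff f n * z ^ n) (f z) := by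
  have h : HasSum (fun n : ℕ => (n.factorial : ℂ)⁻¹ • (z - 0) ^ n • iteratedDeriv n f 0) (f z) :=
    Complex.hasSum_taylorSeries_on_ball hf hz
  refine h.congr_fun fun n => ?_
  simp only [maclaurinCoeff, sub_zero, smul_eq_mul]
  ring

theorem maclaurinCoeff_deriv (g : ℂ → ℂ) (n : ℕ) :
    maclaurinCoeff (deriv g) n = (n + 1) * maclaurinCoeff g (n + 1) := by
  have h1 : ((n : ℂ) + 1) ≠ 0 := by exact_mod_cast n.succ_ne_zero
  have h2 : (n.factorial : ℂ) ≠ 0 := by exact_mod_cast n.factorial_ne_zero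
  rw [maclaurinCoeff, maclaurinCoeff, ← iteratedDeriv_succ', Nat.factorial_succ]
  push_cast
  field_simp

theorem maclaurinCoeff_eq_of_hasSum {f : ℂ → ℂ} {a : ℕ → ℂ}
    (h : ∀ z ∈ unitDisc, HasSum (fun n => a n * z ^ n) (f z)) (hf : DifferentiableOn ℂ f unitDisc)
    (n : ℕ) : maclaurinCoeff f n = a n := by
  have hnhds : unitDisc ∈ 𝓝 (0 : ℂ) := Metric.ball_mem_nhds 0 one_pos
  have h1 := (hf.analyticAt hnhds).hasFPowerSeriesAt
  have h2 : HasFPowerSeriesAt f (FormalMultilinearSeries.ofScalars ℂ a) 0 := by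
    rw [hasFPowerSeriesAt_iff]
    filter_upwards [hnhds] with z hz
    simpa [mul_comm] using h z hz
  have := congrArg (fun p => FormalMultilinearSeries.coeff p n)
    (h1.eq_formalMultilinearSeries h2)
  simpa [maclaurinCoeff, FormalMultilinearSeries.coeff_ofScalars] using this

theorem mul_mem_unitDisc {t : ℝ} (ht : t ∈ Set.Icc (0 : ℝ) 1) {z : ℂ} (hz : z ∈ unitDisc) :
    (t : ℂ) * z ∈ unitDisc := by
  simp only [unitDisc, mem_ball_zero_iff, norm_mul, Complex.norm_real] at *
  rw [Real.norm_of_nonneg ht.1]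
  nlinarith [norm_nonneg z, ht.1, ht.2]

/-- The sum of the Maclaurin coefficients of `g'`. -/
noncomputable def derivCoeffSum (g : ℂ → ℂ) : ℝ≥0∞ :=
  ∑' n : ℕ, ENNReal.ofReal (((n : ℝ) + 1) * (maclaurinCoeff g (n + 1)).re)

/-- The weights `(k + 1) / (n + k + 1)` are at most `1` and tend to `1` as `k → ∞`. The first fact
gives one inequality termwise, the second gives the other on finite partial sums. -/
theorem coeffSup_eq_derivCoeffSum {g : ℂ → ℂ} (hg : ∀ n, 0 ≤ (maclaurinCoeff g n).re) :
    coeffSup g = derivCoeffSum g := by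
  have hterm : ∀ k n : ℕ, ((k : ℝ≥0∞) + 1) * ENNReal.ofReal
      (((n : ℝ) + 1) * (maclaurinCoeff g (n + 1)).re / ((n : ℝ) + (k : ℝ) + 1)) =
      ENNReal.ofReal (((n : ℝ) + 1) * (maclaurinCoeff g (n + 1)).re *
        (((k + 1 : ℕ) : ℝ) / (((k + 1 : ℕ) : ℝ) + n))) := by
    intro k n
    rw [show ((k : ℝ≥0∞) + 1) = ENNReal.ofReal ((k : ℝ) + 1) by
      rw [ENNReal.ofReal_add (by positivity) zero_le_one]; simp,
      ← ENNReal.ofReal_mul (by positivity)]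
    congr 1
    push_cast
    rw [show (k : ℝ) + 1 + n = n + k + 1 by ring]
    ring
  unfold coeffSup derivCoeffSum
  simp only [← ENNReal.tsum_mul_left, hterm]
  apply le_antisymm
  · refine iSup_le fun k => ENNReal.tsum_le_tsum fun n => ENNReal.ofReal_le_ofReal ?_
    refine mul_le_of_le_one_right (mul_nonneg (by positivity) (hg _)) ?_
    exact div_le_one_of_le₀ (by simp) (by positivity)
  · rw [ENNReal.tsum_eq_iSup_nat]
    refine iSup_le fun N => ?_
    have hlim : Tendsto (fun k : ℕ => ∑ n ∈ Finset.range N,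
        ENNReal.ofReal (((n : ℝ) + 1) * (maclaurinCoeff g (n + 1)).re *
          (((k + 1 : ℕ) : ℝ) / (((k + 1 : ℕ) : ℝ) + n)))) atTop
        (𝓝 (∑ n ∈ Finset.range N,
          ENNReal.ofReal (((n : ℝ) + 1) * (maclaurinCoeff g (n + 1)).re))) := by
      refine tendsto_finsetSum _ fun n _ => ENNReal.tendsto_ofReal ?_
      have := ((tendsto_natCast_div_add_atTop (n : ℝ)).comp (tendsto_add_atTop_nat 1)).const_mul
        (((n : ℝ) + 1) * (maclaurinCoeff g (n + 1)).re)
      rwa [mul_one] at this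
    refine le_of_tendsto' hlim fun k => ?_
    exact (ENNReal.sum_le_tsum _).trans (le_iSup (fun k : ℕ => ∑' n : ℕ,
      ENNReal.ofReal (((n : ℝ) + 1) * (maclaurinCoeff g (n + 1)).re *
          (((k + 1 : ℕ) : ℝ) / (((k + 1 : ℕ) : ℝ) + n)))) k)

theorem enorm_deriv_le_derivCoeffSum {g : ℂ → ℂ} (hd : DifferentiableOn ℂ g unitDisc)
    (hg : ∀ n, 0 ≤ (maclaurinCoeff g n).re ∧ (maclaurinCoeff g n).im = 0) {z : ℂ}
    (hz : z ∈ unitDisc) : ‖deriv g z‖ₑ ≤ derivCoeffSum g := by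
  have hs := hasSum_maclaurinCoeff (hd.deriv Metric.isOpen_ball) hz
  rw [← hs.tsum_eq]
  refine enorm_tsum_le_tsum_enorm.trans (ENNReal.tsum_le_tsum fun n => ?_)
  have hz' : ‖z‖ ≤ 1 := (mem_ball_zero_iff.1 hz).le
  rw [← ofReal_norm]
  refine ENNReal.ofReal_le_ofReal ?_
  have h1 : maclaurinCoeff g (n + 1) = ((maclaurinCoeff g (n + 1)).re : ℂ) :=
    Complex.ext rfl (by simp [(hg (n + 1)).2])
  have h2 : ‖maclaurinCoeff g (n + 1)‖ = (maclaurinCoeff g (n + 1)).re := by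
    rw [h1, Complex.norm_real, Real.norm_of_nonneg (hg _).1, Complex.ofReal_re]
  have h3 : ‖(n : ℂ) + 1‖ = (n : ℝ) + 1 := by
    have : ((n : ℂ) + 1) = ((n + 1 : ℕ) : ℂ) := by push_cast; rfl
    rw [this, Complex.norm_natCast]
    push_cast; rfl
  rw [maclaurinCoeff_deriv, norm_mul, norm_mul, norm_pow, h2, h3]
  exact mul_le_of_le_one_right (mul_nonneg (by positivity) (hg _).1)
    (pow_le_one₀ (norm_nonneg z) hz')

end Coefficients

/-! ### Integral means -/

section IntegralMeans

open MeasureTheory Filter Topology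

theorem continuous_comp_circleMap {f : ℂ → ℂ} (hf : ContinuousOn f unitDisc) {ρ : ℝ}
    (h0 : 0 ≤ ρ) (h1 : ρ < 1) : Continuous fun θ : ℝ => f (circleMap 0 ρ θ) :=
  hf.comp_continuous (continuous_circleMap 0 ρ) (circleMap_mem_unitBall h0 h1)

theorem integralMeanOne_eq {f : ℂ → ℂ} (hf : ContinuousOn f unitDisc) {ρ : ℝ}
    (h0 : 0 ≤ ρ) (h1 : ρ < 1) :
    integralMeanOne ρ f = ENNReal.ofReal
      (1 / (2 * Real.pi) * ∫ θ in (-Real.pi)..Real.pi, ‖f (circleMap 0 ρ θ)‖) := by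
  have hc := continuous_comp_circleMap hf h0 h1
  have hpi := Real.pi_pos.le
  have hper : Function.Periodic (fun θ : ℝ => ‖f (circleMap 0 ρ θ)‖) (2 * Real.pi) := by
    intro θ
    simp only [periodic_circleMap 0 ρ θ]
  have h2 : ∫ θ in (-Real.pi)..Real.pi, ‖f (circleMap 0 ρ θ)‖ =
      ∫ θ in (0 : ℝ)..(2 * Real.pi), ‖f (circleMap 0 ρ θ)‖ := by
    have := hper.intervalIntegral_add_eq (-Real.pi) 0
    convert this using 2 <;> ring
  rw [integralMeanOne, h2, ENNReal.ofReal_mul (by positivity),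
    intervalIntegral.integral_of_le (by linarith), ofReal_integral_norm_eq_lintegral_enorm]
  exact (intervalIntegrable_iff_integrableOn_Ioc_of_le (by linarith)).1
    (hc.intervalIntegrable 0 (2 * Real.pi))

/-- The interval `(-π, π)` is the angular range of `polarCoord`, whereas `integralMeanOne` uses `(0,
2π]`. -/
theorem lintegral_enorm_circleMap {f : ℂ → ℂ} (hf : ContinuousOn f unitDisc) {ρ : ℝ}
    (h0 : 0 ≤ ρ) (h1 : ρ < 1) :
    ∫⁻ θ in Set.Ioo (-Real.pi) Real.pi, ‖f (circleMap 0 ρ θ)‖ₑ =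
      ENNReal.ofReal (2 * Real.pi) * integralMeanOne ρ f := by
  have hc := continuous_comp_circleMap hf h0 h1
  have hpi := Real.pi_pos
  have hle : -Real.pi ≤ Real.pi := by linarith
  rw [integralMeanOne_eq hf h0 h1, ← ENNReal.ofReal_mul (by positivity), ← mul_assoc,
    mul_one_div_cancel (by positivity), one_mul, intervalIntegral.integral_of_le hle,
    ofReal_integral_norm_eq_lintegral_enorm, restrict_Ioo_eq_restrict_Ioc]
  exact (intervalIntegrable_iff_integrableOn_Ioc_of_le hle).1 (hc.intervalIntegrable _ _)

theorem lintegral_unitDisc_eq {f : ℂ → ℂ} (hf : ContinuousOn f unitDisc) :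
    ∫⁻ z in unitDisc, ‖f z‖ₑ = ENNReal.ofReal (2 * Real.pi) *
      ∫⁻ ρ in Set.Ioo (0 : ℝ) 1, ENNReal.ofReal ρ * integralMeanOne ρ f := by
  have hm : MeasurableSet unitDisc := measurableSet_ball
  set A : Set (ℝ × ℝ) := Set.Ioo (0 : ℝ) 1 ×ˢ Set.Ioo (-Real.pi) Real.pi with hA
  have hAm : MeasurableSet A := measurableSet_Ioo.prod measurableSet_Ioo
  have hsymm : ∀ p : ℝ × ℝ, Complex.polarCoord.symm p = circleMap 0 p.1 p.2 := by
    intro p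
    rw [Complex.polarCoord_symm_apply, circleMap, Complex.exp_mul_I]
    simp
  have hset : ∀ p ∈ polarCoord.target,
      ENNReal.ofReal p.1 • unitDisc.indicator (fun z => ‖f z‖ₑ) (Complex.polarCoord.symm p) =
      A.indicator (fun p : ℝ × ℝ => ENNReal.ofReal p.1 * ‖f (circleMap 0 p.1 p.2)‖ₑ) p := by
    intro p hp
    have hp' : 0 < p.1 ∧ p.2 ∈ Set.Ioo (-Real.pi) Real.pi := by
      simpa [polarCoord_target] using hp
    rw [hsymm]
    by_cases h : p.1 < 1
    · rw [Set.indicator_of_mem (show circleMap 0 p.1 p.2 ∈ unitDisc from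
          circleMap_mem_unitBall hp'.1.le h _),
        Set.indicator_of_mem (show p ∈ A from ⟨⟨hp'.1, h⟩, hp'.2⟩), smul_eq_mul]
    · rw [Set.indicator_of_notMem, Set.indicator_of_notMem, smul_zero]
      · exact fun hpA => h hpA.1.2
      · intro hu
        apply h
        simpa [unitDisc, abs_of_pos hp'.1] using hu
  have hAsub : A ⊆ polarCoord.target := by
    rintro p ⟨h1, h2⟩
    exact ⟨h1.1, h2⟩
  have hae : AEMeasurable (fun p : ℝ × ℝ => ENNReal.ofReal p.1 * ‖f (circleMap 0 p.1 p.2)‖ₑ)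
      (volume.restrict A) := by
    refine AEMeasurable.mul
      (ENNReal.measurable_ofReal.comp measurable_fst).aemeasurable ?_
    refine ContinuousOn.aemeasurable ?_ hAm
    refine ContinuousOn.enorm (hf.comp ?_ ?_)
    · unfold circleMap
      fun_prop
    · rintro p ⟨h1, _⟩
      exact circleMap_mem_unitBall h1.1.le h1.2 _
  rw [← lintegral_indicator hm, ← Complex.lintegral_comp_polarCoord_symm,
    setLIntegral_congr_fun polarCoord.open_target.measurableSet hset,
    lintegral_indicator hAm, Measure.restrict_restrict hAm, Set.inter_eq_left.2 hAsub]
  rw [hA, Measure.volume_eq_prod, ← Measure.prod_restrict] at hae ⊢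
  rw [lintegral_prod _ hae, ← lintegral_const_mul' _ _ ENNReal.ofReal_ne_top]
  refine setLIntegral_congr_fun measurableSet_Ioo fun ρ hρ => ?_
  simp only
  rw [lintegral_const_mul' _ _ ENNReal.ofReal_ne_top,
    lintegral_enorm_circleMap hf hρ.1.le hρ.2]
  ring

theorem dirichletOneNorm_eq {f : ℂ → ℂ} (hf : DifferentiableOn ℂ f unitDisc) :
    dirichletOneNorm f = 2 * (∫⁻ ρ in Set.Ioo (0 : ℝ) 1,
      ENNReal.ofReal ρ * integralMeanOne ρ (deriv f)) + ‖f 0‖ₑ := by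
  rw [dirichletOneNorm, lintegral_unitDisc_eq (hf.deriv Metric.isOpen_ball).continuousOn,
    ← mul_assoc, ← ENNReal.ofReal_mul (by positivity)]
  congr 2
  rw [show 1 / Real.pi * (2 * Real.pi) = 2 by field_simp]
  simp

end IntegralMeans

/-! ### Integrals along radii -/

section Radii

open MeasureTheory Filter Topology

theorem continuousOn_comp_ofReal_mul {f : ℂ → ℂ} (hf : ContinuousOn f unitDisc) {z : ℂ}
    (hz : z ∈ unitDisc) : ContinuousOn (fun t : ℝ => f (t * z)) (Set.Icc 0 1) :=
  hf.comp (by fun_prop) fun _ ht => mul_mem_unitDisc ht hz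

theorem lintegral_radius_le_integralMeanOne {f : ℂ → ℂ} (hf : DifferentiableOn ℂ f unitDisc)
    {z : ℂ} (hz : z ∈ unitDisc) :
    ∫⁻ t in Set.Ioc (0 : ℝ) 1, ‖f (t * z)‖ₑ ≤
      ENNReal.ofReal Real.pi * integralMeanOne ‖z‖ f := by
  have hpi := Real.pi_pos
  rw [integralMeanOne_eq hf.continuousOn (norm_nonneg z) (mem_ball_zero_iff.1 hz),
    ← ENNReal.ofReal_mul hpi.le, ← ofReal_integral_norm_eq_lintegral_enorm,
    ← intervalIntegral.integral_of_le zero_le_one]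
  · refine ENNReal.ofReal_le_ofReal ((fejerRiesz hf hz).trans_eq ?_)
    field_simp
  · exact ((continuousOn_comp_ofReal_mul hf.continuousOn hz).integrableOn_Icc).mono_set
      Set.Ioc_subset_Icc_self

theorem integral_radius_eq_sub {h F : ℂ → ℂ} (hh : ContinuousOn h unitDisc)
    (hF : ∀ z ∈ unitDisc, HasDerivAt F (h z) z) {z : ℂ} (hz : z ∈ unitDisc) :
    ∫ t in (0 : ℝ)..1, h (t * z) * z = F z - F 0 := by
  have := intervalIntegral.integral_eq_sub_of_hasDerivAt (a := 0) (b := 1)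
    (f := fun t : ℝ => F (t * z)) (f' := fun t : ℝ => h (t * z) * z) ?_ ?_
  · simpa using this
  · intro t ht
    rw [Set.uIcc_of_le zero_le_one] at ht
    have h1 : HasDerivAt (fun w : ℂ => w * z) z (t : ℂ) := by
      simpa using (hasDerivAt_id (t : ℂ)).mul_const z
    exact ((hF _ (mul_mem_unitDisc ht hz)).comp (t : ℂ) h1).comp_ofReal
  · apply ContinuousOn.intervalIntegrable
    rw [Set.uIcc_of_le zero_le_one]
    exact (continuousOn_comp_ofReal_mul hh hz).mul continuousOn_const

theorem enorm_integral_radius_le (h : ℂ → ℂ) (z : ℂ) :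
    ‖∫ t in (0 : ℝ)..1, h (t * z) * z‖ₑ ≤ ‖z‖ₑ * ∫⁻ t in Set.Ioc (0 : ℝ) 1, ‖h (t * z)‖ₑ := by
  rw [intervalIntegral.integral_of_le zero_le_one, ← lintegral_const_mul' _ _ enorm_ne_top]
  refine (enorm_integral_le_lintegral_enorm _).trans_eq ?_
  simp only [enorm_mul, mul_comm]

theorem radius_le_hardyOneNorm {f : ℂ → ℂ} (hf : DifferentiableOn ℂ f unitDisc)
    {z : ℂ} (hz : z ∈ unitDisc) :
    ‖z‖ₑ * ∫⁻ t in Set.Ioc (0 : ℝ) 1, ‖f (t * z)‖ₑ ≤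
      ENNReal.ofReal Real.pi * hardyOneNorm f := by
  have hz1 : ‖z‖ < 1 := mem_ball_zero_iff.1 hz
  -- The supremum in `hardyOneNorm` runs over positive radii only, so the centre is separate.
  rcases eq_or_ne z 0 with rfl | hz0
  · simp
  · calc ‖z‖ₑ * ∫⁻ t in Set.Ioc (0 : ℝ) 1, ‖f (t * z)‖ₑ
        ≤ 1 * (ENNReal.ofReal Real.pi * integralMeanOne ‖z‖ f) := by
          gcongr
          · rw [← ofReal_norm]
            exact ENNReal.ofReal_le_one.2 hz1.le
          · exact lintegral_radius_le_integralMeanOne hf hz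
      _ ≤ _ := by
          rw [one_mul]
          gcongr
          exact le_iSup₂_of_le (f := fun r (_ : r ∈ Set.Ioo (0 : ℝ) 1) => integralMeanOne r f)
            ‖z‖ ⟨norm_pos_iff.2 hz0, hz1⟩ le_rfl

/-- Integrating `f'` from `0` to `t z` and applying Fejér–Riesz to `f'` bounds `|f(t z)|` by `|f(0)|
+ π ρ M_1(ρ, f')` with `ρ = ‖z‖ t`. The length `ρ` of the segment is the polar Jacobian, so
integrating in `t` yields the area integral of `|f'|`. -/
theorem radius_le_dirichletOneNorm {f : ℂ → ℂ} (hf : DifferentiableOn ℂ f unitDisc)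
    {z : ℂ} (hz : z ∈ unitDisc) :
    ‖z‖ₑ * ∫⁻ t in Set.Ioc (0 : ℝ) 1, ‖f (t * z)‖ₑ ≤
      ENNReal.ofReal Real.pi * dirichletOneNorm f := by
  have hz1 : ‖z‖ < 1 := mem_ball_zero_iff.1 hz
  have hf' : DifferentiableOn ℂ (deriv f) unitDisc := hf.deriv Metric.isOpen_ball
  rcases eq_or_ne z 0 with rfl | hz0
  · simp
  have hzp : 0 < ‖z‖ := norm_pos_iff.2 hz0
  set G : ℝ → ℝ≥0∞ := fun ρ => ENNReal.ofReal ρ * integralMeanOne ρ (deriv f) with hG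
  have hpoint : ∀ t ∈ Set.Ioc (0 : ℝ) 1, ‖f (t * z)‖ₑ ≤
      ‖f 0‖ₑ + ENNReal.ofReal Real.pi * G (‖z‖ * t) := by
    intro t ht
    have htz := mul_mem_unitDisc ⟨ht.1.le, ht.2⟩ hz
    have h1 := integral_radius_eq_sub hf'.continuousOn
      (fun w hw => (hf.differentiableAt (Metric.isOpen_ball.mem_nhds hw)).hasDerivAt) htz
    have hn : ‖(t : ℂ) * z‖ = ‖z‖ * t := by
      rw [norm_mul, Complex.norm_real, Real.norm_of_nonneg ht.1.le, mul_comm]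
    have h2 : f (t * z) = f 0 + ∫ s in (0 : ℝ)..1, deriv f (s * (t * z)) * (t * z) := by
      rw [h1]; ring
    rw [h2]
    refine (enorm_add_le _ _).trans ?_
    gcongr
    refine (enorm_integral_radius_le _ _).trans ?_
    rw [← ofReal_norm, hn, hG]
    calc ENNReal.ofReal (‖z‖ * t) * ∫⁻ s in Set.Ioc (0 : ℝ) 1, ‖deriv f (s * (t * z))‖ₑ
        ≤ ENNReal.ofReal (‖z‖ * t) *
          (ENNReal.ofReal Real.pi * integralMeanOne ‖(t : ℂ) * z‖ (deriv f)) := by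
          gcongr
          exact lintegral_radius_le_integralMeanOne hf' htz
      _ = _ := by rw [hn]; ring
  have hcov : ENNReal.ofReal ‖z‖ * ∫⁻ t in Set.Ioc (0 : ℝ) 1, G (‖z‖ * t) ≤
      ∫⁻ ρ in Set.Ioo (0 : ℝ) 1, G ρ := by
    have h1 := lintegral_image_eq_lintegral_abs_deriv_mul (s := Set.Ioc (0 : ℝ) 1)
      (f := fun t => ‖z‖ * t) (f' := fun _ => ‖z‖) measurableSet_Ioc
      (fun x _ => by simpa using ((hasDerivAt_id x).const_mul ‖z‖).hasDerivWithinAt)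
      (fun a _ b _ h => mul_left_cancel₀ hzp.ne' h) G
    rw [← lintegral_const_mul' _ _ ENNReal.ofReal_ne_top]
    simp only [abs_of_pos hzp] at h1
    rw [← h1]
    refine lintegral_mono_set ?_
    rintro _ ⟨t, ht, rfl⟩
    exact ⟨mul_pos hzp ht.1, by nlinarith [ht.1, ht.2]⟩
  calc ‖z‖ₑ * ∫⁻ t in Set.Ioc (0 : ℝ) 1, ‖f (t * z)‖ₑ
      ≤ ‖z‖ₑ * ∫⁻ t in Set.Ioc (0 : ℝ) 1,
          (‖f 0‖ₑ + ENNReal.ofReal Real.pi * G (‖z‖ * t)) := by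
        exact mul_le_mul_right (setLIntegral_mono' measurableSet_Ioc hpoint) _
    _ = ‖z‖ₑ * ‖f 0‖ₑ + ENNReal.ofReal Real.pi *
          (ENNReal.ofReal ‖z‖ * ∫⁻ t in Set.Ioc (0 : ℝ) 1, G (‖z‖ * t)) := by
        rw [lintegral_add_left measurable_const, lintegral_const_mul' _ _ ENNReal.ofReal_ne_top,
          ofReal_norm]
        simp
        ring
    _ ≤ ENNReal.ofReal Real.pi * ‖f 0‖ₑ + ENNReal.ofReal Real.pi *
          (2 * ∫⁻ ρ in Set.Ioo (0 : ℝ) 1, G ρ) := by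
        gcongr ?_ * _ + _ * ?_
        · rw [← ofReal_norm]
          exact ENNReal.ofReal_le_ofReal (by linarith [Real.pi_gt_three])
        · exact hcov.trans (le_mul_of_one_le_left zero_le one_le_two)
    _ = _ := by
        rw [dirichletOneNorm_eq hf]
        ring

/-- The weight `1 / (n + 1)` is `∫_0^1 t^n dt`. The constant `1` would suffice; `π` matches the
other two spaces. -/
theorem radius_le_hardyLittlewoodOneNorm {f : ℂ → ℂ} (hf : DifferentiableOn ℂ f unitDisc)
    {z : ℂ} (hz : z ∈ unitDisc) :
    ‖z‖ₑ * ∫⁻ t in Set.Ioc (0 : ℝ) 1, ‖f (t * z)‖ₑ ≤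
      ENNReal.ofReal Real.pi * hardyLittlewoodOneNorm f := by
  have hz1 : ‖z‖ < 1 := mem_ball_zero_iff.1 hz
  have hpow : ∀ n : ℕ, ∫⁻ t in Set.Ioc (0 : ℝ) 1, ENNReal.ofReal (t ^ n) =
      ((n : ℝ≥0∞) + 1)⁻¹ := by
    intro n
    rw [← ofReal_integral_eq_lintegral_ofReal, ← intervalIntegral.integral_of_le zero_le_one,
      integral_pow]
    · rw [one_pow, zero_pow n.succ_ne_zero, sub_zero, one_div,
        ENNReal.ofReal_inv_of_pos (by positivity), ENNReal.ofReal_add (by positivity) zero_le_one]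
      simp
    · exact ((continuous_pow n).integrableOn_Icc).mono_set Set.Ioc_subset_Icc_self
    · exact (ae_restrict_iff' measurableSet_Ioc).2
        (Eventually.of_forall fun t ht => pow_nonneg ht.1.le n)
  have hpoint : ∀ t ∈ Set.Ioc (0 : ℝ) 1, ‖f (t * z)‖ₑ ≤
      ∑' n : ℕ, ‖maclaurinCoeff f n‖ₑ * ENNReal.ofReal (t ^ n) := by
    intro t ht
    rw [← (hasSum_maclaurinCoeff hf (mul_mem_unitDisc ⟨ht.1.le, ht.2⟩ hz)).tsum_eq]
    refine enorm_tsum_le_tsum_enorm.trans (ENNReal.tsum_le_tsum fun n => ?_)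
    rw [enorm_mul]
    gcongr
    rw [← ofReal_norm, norm_pow, norm_mul, Complex.norm_real, Real.norm_of_nonneg ht.1.le]
    refine ENNReal.ofReal_le_ofReal (pow_le_pow_left₀ (by have := ht.1; positivity) ?_ n)
    nlinarith [ht.1, norm_nonneg z]
  calc ‖z‖ₑ * ∫⁻ t in Set.Ioc (0 : ℝ) 1, ‖f (t * z)‖ₑ
      ≤ 1 * ∫⁻ t in Set.Ioc (0 : ℝ) 1,
          ∑' n : ℕ, ‖maclaurinCoeff f n‖ₑ * ENNReal.ofReal (t ^ n) := by
        gcongr ?_ * ?_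
        · rw [← ofReal_norm]
          exact ENNReal.ofReal_le_one.2 hz1.le
        · exact setLIntegral_mono' measurableSet_Ioc hpoint
    _ = hardyLittlewoodOneNorm f := by
        rw [one_mul, lintegral_tsum fun n => by fun_prop]
        simp only [lintegral_const_mul' _ _ enorm_ne_top, hpow]
        rfl
    _ ≤ _ := le_mul_of_one_le_left zero_le (by
        rw [← ENNReal.ofReal_one]
        exact ENNReal.ofReal_le_ofReal (by linarith [Real.pi_gt_three]))

end Radii

/-! ### The upper estimate -/

section UpperEstimate

open MeasureTheory

theorem differentiableOn_integralOp {f g : ℂ → ℂ} (hf : DifferentiableOn ℂ f unitDisc)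
    (hg : DifferentiableOn ℂ g unitDisc) : DifferentiableOn ℂ (integralOp g f) unitDisc := by
  have hfg : DifferentiableOn ℂ (fun z => f z * deriv g z) unitDisc :=
    hf.mul (hg.deriv Metric.isOpen_ball)
  obtain ⟨F, hF⟩ := DifferentiableOn.isExactOn_ball hfg
  have hd : DifferentiableOn ℂ (fun z => F z - F 0) unitDisc := fun z hz =>
    ((hF z hz).differentiableAt.sub_const _).differentiableWithinAt
  exact hd.congr fun z hz => integral_radius_eq_sub hfg.continuousOn hF hz

theorem enorm_integralOp_le {f g : ℂ → ℂ} (hg : DifferentiableOn ℂ g unitDisc)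
    (hcoeff : ∀ n, 0 ≤ (maclaurinCoeff g n).re ∧ (maclaurinCoeff g n).im = 0)
    {K : ℝ≥0∞} {z : ℂ} (hz : z ∈ unitDisc)
    (hK : ‖z‖ₑ * ∫⁻ t in Set.Ioc (0 : ℝ) 1, ‖f (t * z)‖ₑ ≤ K) (hS : derivCoeffSum g ≠ ∞) :
    ‖integralOp g f z‖ₑ ≤ derivCoeffSum g * K := by
  refine (enorm_integral_radius_le (fun w => f w * deriv g w) z).trans ?_
  calc ‖z‖ₑ * ∫⁻ t in Set.Ioc (0 : ℝ) 1, ‖f (t * z) * deriv g (t * z)‖ₑ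
      ≤ ‖z‖ₑ * ∫⁻ t in Set.Ioc (0 : ℝ) 1, derivCoeffSum g * ‖f (t * z)‖ₑ := by
        gcongr 1
        refine setLIntegral_mono' measurableSet_Ioc fun t ht => ?_
        rw [enorm_mul, mul_comm]
        gcongr
        exact enorm_deriv_le_derivCoeffSum hg hcoeff (mul_mem_unitDisc ⟨ht.1.le, ht.2⟩ hz)
    _ = derivCoeffSum g * (‖z‖ₑ * ∫⁻ t in Set.Ioc (0 : ℝ) 1, ‖f (t * z)‖ₑ) := by
        rw [lintegral_const_mul' _ _ hS]
        ring
    _ ≤ _ := by gcongr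

end UpperEstimate

/-! ### Test functions -/

section TestFunctions

open MeasureTheory Filter Topology

theorem norm_one_sub_mul_ge {r s : ℝ} (hr : 0 ≤ r) {w : ℂ} (hw : ‖w‖ ≤ s) :
    1 - r * s ≤ ‖1 - (r : ℂ) * w‖ := by
  have h1 : ‖(r : ℂ) * w‖ ≤ r * s := by
    rw [norm_mul, Complex.norm_real, Real.norm_of_nonneg hr]
    gcongr
  have h2 := norm_sub_norm_le (1 : ℂ) ((r : ℂ) * w)
  rw [norm_one] at h2
  linarith

theorem one_sub_mul_ne_zero {r : ℝ} (hr : r ∈ Set.Ioo (0 : ℝ) 1) {z : ℂ} (hz : z ∈ unitDisc) :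
    1 - (r : ℂ) * z ≠ 0 := by
  have h := norm_one_sub_mul_ge hr.1.le (mem_ball_zero_iff.1 hz).le
  exact norm_pos_iff.1 (by linarith [hr.2])

/-- Up to the factor `1 - ρ²`, the integrand is the Poisson kernel, the real part of `(1 + w) / (1 -
w)`, whose mean over the circle is its value `1` at `0`. -/
theorem integral_inv_norm_one_sub_sq {ρ : ℝ} (h0 : 0 ≤ ρ) (h1 : ρ < 1) :
    ∫ θ in (0 : ℝ)..(2 * Real.pi), 1 / ‖1 - circleMap 0 ρ θ‖ ^ 2 =
      2 * Real.pi / (1 - ρ ^ 2) := by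
  set h : ℂ → ℂ := fun w => (1 + w) / (1 - w) with hh
  have hne : ∀ w ∈ Metric.closedBall (0 : ℂ) ρ, 1 - w ≠ 0 := by
    intro w hw
    have hw' : ‖w‖ ≤ ρ := mem_closedBall_zero_iff.1 hw
    have := norm_one_sub_mul_ge (r := 1) zero_le_one hw'
    simp only [Complex.ofReal_one, one_mul] at this
    exact norm_pos_iff.1 (by linarith)
  have hd : DifferentiableOn ℂ h (Metric.closedBall 0 ρ) :=
    DifferentiableOn.div (by fun_prop) (by fun_prop) hne
  have havg : Real.circleAverage h 0 ρ = h 0 := by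
    apply DiffContOnCl.circleAverage
    rw [abs_of_nonneg h0]
    exact hd.diffContOnCl_ball subset_rfl
  have hint : IntervalIntegrable (fun θ => h (circleMap 0 ρ θ)) volume 0 (2 * Real.pi) := by
    refine (hd.continuousOn.comp_continuous (continuous_circleMap 0 ρ) fun θ => ?_).intervalIntegrable
      _ _
    simp [abs_of_nonneg h0]
  have hre : ∫ θ in (0 : ℝ)..(2 * Real.pi), (h (circleMap 0 ρ θ)).re = 2 * Real.pi := by
    have e := Complex.reCLM.intervalIntegral_comp_comm hint
    simp only [Complex.reCLM_apply] at e
    rw [e]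
    have e2 : (∫ θ in (0 : ℝ)..(2 * Real.pi), h (circleMap 0 ρ θ)) = 2 * Real.pi := by
      rw [Real.circleAverage_def, Complex.real_smul] at havg
      have hp : (Real.pi : ℂ) ≠ 0 := by exact_mod_cast Real.pi_ne_zero
      push_cast at havg
      field_simp at havg
      rw [havg]
      simp [hh]
    rw [e2]
    simp
  have hpt : ∀ θ : ℝ, 1 / ‖1 - circleMap 0 ρ θ‖ ^ 2 =
      (1 - ρ ^ 2)⁻¹ * (h (circleMap 0 ρ θ)).re := by
    intro θ
    have hn : ‖circleMap 0 ρ θ‖ ^ 2 = ρ ^ 2 := by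
      rw [norm_circleMap_zero, sq_abs]
    set w := circleMap 0 ρ θ
    have hw : 1 - w ≠ 0 := hne w (by simp [w, abs_of_nonneg h0])
    have hρ : 0 < 1 - ρ ^ 2 := by nlinarith
    have hnum : (h w).re = (1 - ρ ^ 2) / ‖1 - w‖ ^ 2 := by
      rw [← hn, ← Complex.normSq_eq_norm_sq, ← Complex.normSq_eq_norm_sq, hh, Complex.div_re,
        ← add_div]
      congr 1
      simp only [Complex.add_re, Complex.one_re, Complex.sub_re, Complex.add_im, Complex.one_im,
        Complex.sub_im, Complex.normSq_apply]
      ring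
    rw [hnum]
    field_simp
  simp only [hpt]
  rw [intervalIntegral.integral_const_mul, hre]
  ring

theorem integralMeanOne_le {f : ℂ → ℂ} {r s K : ℝ} (hr : r ∈ Set.Ioo (0 : ℝ) 1)
    (hs : s ∈ Set.Ioo (0 : ℝ) 1) (hK : 0 ≤ K)
    (hf : ∀ w : ℂ, ‖w‖ = s → ‖f w‖ ≤ K / ‖1 - (r : ℂ) * w‖ ^ 2) :
    integralMeanOne s f ≤ ENNReal.ofReal (K / (1 - (r * s) ^ 2)) := by
  have hρ0 : 0 ≤ r * s := (mul_pos hr.1 hs.1).le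
  have hρ1 : r * s < 1 := by nlinarith [hr.1, hr.2, hs.1, hs.2]
  have hpi := Real.pi_pos
  have hmul : ∀ θ : ℝ, (r : ℂ) * circleMap 0 s θ = circleMap 0 (r * s) θ := by
    intro θ
    simp [circleMap, mul_assoc]
  have hc : Continuous fun θ : ℝ => K * (1 / ‖1 - circleMap 0 (r * s) θ‖ ^ 2) := by
    refine continuous_const.mul (continuous_const.div
      ((continuous_const.sub (continuous_circleMap 0 (r * s))).norm.pow 2) fun θ => ?_)
    rw [← hmul]
    have := one_sub_mul_ne_zero hr (circleMap_mem_unitBall hs.1.le hs.2 θ)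
    positivity
  rw [integralMeanOne]
  calc ENNReal.ofReal (1 / (2 * Real.pi)) *
        ∫⁻ θ in Set.Ioc (0 : ℝ) (2 * Real.pi), ‖f (circleMap 0 s θ)‖ₑ
      ≤ ENNReal.ofReal (1 / (2 * Real.pi)) * ∫⁻ θ in Set.Ioc (0 : ℝ) (2 * Real.pi),
          ENNReal.ofReal (K * (1 / ‖1 - circleMap 0 (r * s) θ‖ ^ 2)) := by
        gcongr with θ
        rw [← ofReal_norm]
        refine ENNReal.ofReal_le_ofReal ?_
        have := hf (circleMap 0 s θ) (by simp [abs_of_pos hs.1])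
        rwa [hmul, div_eq_mul_one_div] at this
    _ = ENNReal.ofReal (1 / (2 * Real.pi) * (K * (2 * Real.pi / (1 - (r * s) ^ 2)))) := by
        rw [← ofReal_integral_eq_lintegral_ofReal, ← intervalIntegral.integral_of_le (by linarith),
          intervalIntegral.integral_const_mul, integral_inv_norm_one_sub_sq hρ0 hρ1,
          ← ENNReal.ofReal_mul (by positivity)]
        · exact (intervalIntegrable_iff_integrableOn_Ioc_of_le (by linarith)).1
            (hc.intervalIntegrable _ _)
        · exact Eventually.of_forall fun θ => by positivity
    _ = _ := by
        congr 1
        field_simp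

/-- The Bergman-type kernels on which the lower estimate is tested. -/
noncomputable def kernelFun (r : ℝ) (z : ℂ) : ℂ := ((1 - r ^ 2) / 9 : ℝ) / (1 - (r : ℂ) * z) ^ 2

theorem hasDerivAt_kernelFun {r : ℝ} (hr : r ∈ Set.Ioo (0 : ℝ) 1) {z : ℂ} (hz : z ∈ unitDisc) :
    HasDerivAt (kernelFun r)
      (((1 - r ^ 2) / 9 : ℝ) * (2 * r) / (1 - (r : ℂ) * z) ^ 3) z := by
  have hne := one_sub_mul_ne_zero hr hz
  have h1 : HasDerivAt (fun w : ℂ => 1 - (r : ℂ) * w) (-r) z := by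
    simpa using ((hasDerivAt_id z).const_mul (r : ℂ)).const_sub 1
  have h2 := ((h1.pow 2).inv (pow_ne_zero 2 hne)).const_mul (((1 - r ^ 2) / 9 : ℝ) : ℂ)
  refine h2.congr_deriv ?_
  simp only [Pi.pow_apply]
  field_simp
  push_cast
  ring

theorem differentiableOn_kernelFun {r : ℝ} (hr : r ∈ Set.Ioo (0 : ℝ) 1) :
    DifferentiableOn ℂ (kernelFun r) unitDisc := fun _ hz =>
  (hasDerivAt_kernelFun hr hz).differentiableAt.differentiableWithinAt

theorem hardyOneNorm_kernelFun_le {r : ℝ} (hr : r ∈ Set.Ioo (0 : ℝ) 1) :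
    hardyOneNorm (kernelFun r) ≤ 1 := by
  obtain ⟨h0, h1⟩ := hr
  have hr2 : 0 ≤ (1 - r ^ 2) / 9 := by nlinarith
  refine iSup₂_le fun s hs => (integralMeanOne_le (K := (1 - r ^ 2) / 9) ⟨h0, h1⟩ hs hr2 ?_).trans ?_
  · intro w _
    rw [kernelFun, norm_div, norm_pow, Complex.norm_real, Real.norm_of_nonneg hr2]
  · have hrs : r * s ≤ r := by nlinarith [hs.2]
    have hrs0 : 0 < r * s := mul_pos h0 hs.1
    refine ENNReal.ofReal_le_one.2 ?_
    rw [div_le_one (by nlinarith)]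
    nlinarith

/-- The derivative has a cube in its denominator: one factor is bounded by its minimum `1 - r s` on
the circle of radius `s`, the other two are integrated exactly. What remains is at most a multiple
of `r / (1 - r s)²`, whose integral `1 / (1 - r) - 1` is absorbed by `1 - r²`. -/
theorem dirichletOneNorm_kernelFun_le {r : ℝ} (hr : r ∈ Set.Ioo (0 : ℝ) 1) :
    dirichletOneNorm (kernelFun r) ≤ 1 := by
  rw [dirichletOneNorm_eq (differentiableOn_kernelFun hr)]
  obtain ⟨h0, h1⟩ := id hr
  have hr2 : 0 ≤ (1 - r ^ 2) / 9 := by nlinarith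
  have hpos : ∀ s ∈ Set.Icc (0 : ℝ) 1, 0 < 1 - r * s := by
    intro s hs
    nlinarith [hs.1, hs.2]
  have hzero : ‖kernelFun r 0‖ₑ = ENNReal.ofReal ((1 - r ^ 2) / 9) := by
    rw [← ofReal_norm]
    congr 1
    simp only [kernelFun, mul_zero, sub_zero, one_pow, div_one, Complex.norm_real]
    exact Real.norm_of_nonneg hr2
  have hmean : ∀ s ∈ Set.Ioo (0 : ℝ) 1,
      ENNReal.ofReal s * integralMeanOne s (deriv (kernelFun r)) ≤
        ENNReal.ofReal (2 * (1 - r ^ 2) / 9 * (r / (1 - r * s) ^ 2)) := by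
    intro s hs
    have hs1 := hpos s ⟨hs.1.le, hs.2.le⟩
    have hrs : 0 < r * s := mul_pos h0 hs.1
    have hb : 0 < 1 - (r * s) ^ 2 := by nlinarith
    have := integralMeanOne_le (f := deriv (kernelFun r))
      (K := (1 - r ^ 2) / 9 * (2 * r) / (1 - r * s)) hr hs (by positivity) (by
        intro w hw
        have hwd : w ∈ unitDisc := mem_ball_zero_iff.2 (hw ▸ hs.2)
        have hge := norm_one_sub_mul_ge h0.le hw.le
        have hp : 0 < ‖1 - (r : ℂ) * w‖ := hs1.trans_le hge
        rw [(hasDerivAt_kernelFun hr hwd).deriv, norm_div, norm_pow, norm_mul, norm_mul,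
          Complex.norm_real, Complex.norm_real, Real.norm_of_nonneg hr2, Real.norm_of_nonneg h0.le,
          Complex.norm_two, div_div]
        refine div_le_div_of_nonneg_left (by positivity) (by positivity) ?_
        rw [pow_succ' _ 2]
        gcongr)
    calc ENNReal.ofReal s * integralMeanOne s (deriv (kernelFun r))
        ≤ 1 * ENNReal.ofReal ((1 - r ^ 2) / 9 * (2 * r) / (1 - r * s) / (1 - (r * s) ^ 2)) := by
          gcongr
          exact ENNReal.ofReal_le_one.2 hs.2.le
      _ ≤ _ := by
          rw [one_mul]
          refine ENNReal.ofReal_le_ofReal ?_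
          have e : 2 * (1 - r ^ 2) / 9 * (r / (1 - r * s) ^ 2) =
              (1 - r ^ 2) / 9 * (2 * r) / (1 - r * s) / (1 - r * s) := by
            field_simp
          rw [e]
          refine div_le_div_of_nonneg_left (by positivity) hs1 ?_
          nlinarith
  have hne : ∀ s ∈ Set.uIcc (0 : ℝ) 1, 1 - r * s ≠ 0 := by
    intro s hs
    rw [Set.uIcc_of_le zero_le_one] at hs
    exact (hpos s hs).ne'
  have hcont : ContinuousOn (fun s : ℝ => r / (1 - r * s) ^ 2) (Set.uIcc 0 1) :=
    ContinuousOn.div (by fun_prop) (by fun_prop) fun s hs => pow_ne_zero 2 (hne s hs)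
  have hint : ∫ s in (0 : ℝ)..1, r / (1 - r * s) ^ 2 = (1 - r)⁻¹ - 1 := by
    rw [intervalIntegral.integral_eq_sub_of_hasDerivAt (f := fun s => (1 - r * s)⁻¹) ?_
      hcont.intervalIntegrable]
    · simp
    · intro s hs
      have h2 : HasDerivAt (fun s : ℝ => 1 - r * s) (-r) s := by
        simpa using ((hasDerivAt_id s).const_mul r).const_sub 1
      simpa using h2.fun_inv (hne s hs)
  have hJ : ∫⁻ s in Set.Ioo (0 : ℝ) 1,
      ENNReal.ofReal s * integralMeanOne s (deriv (kernelFun r)) ≤ ENNReal.ofReal (4 / 9) := by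
    refine (setLIntegral_mono' measurableSet_Ioo hmean).trans ?_
    rw [restrict_Ioo_eq_restrict_Ioc, ← ofReal_integral_eq_lintegral_ofReal,
      ← intervalIntegral.integral_of_le zero_le_one, intervalIntegral.integral_const_mul, hint]
    · refine ENNReal.ofReal_le_ofReal ?_
      have hr1 : 1 - r ≠ 0 := by linarith
      have e : 2 * (1 - r ^ 2) / 9 * ((1 - r)⁻¹ - 1) = 2 / 9 * (1 + r) * r := by
        field_simp
        ring
      rw [e]
      nlinarith
    · exact (intervalIntegrable_iff_integrableOn_Ioc_of_le zero_le_one).1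
        (hcont.intervalIntegrable.const_mul _)
    · refine Eventually.of_forall fun s => ?_
      have : 0 ≤ 1 - r ^ 2 := by nlinarith
      simp only [Pi.zero_apply]
      positivity
  -- The bound is at most `8/9 + 1/9`, which explains the normalisation by `9` in the kernel.
  calc _ ≤ 2 * ENNReal.ofReal (4 / 9) + ENNReal.ofReal ((1 - r ^ 2) / 9) := by
        rw [hzero]
        gcongr
    _ = ENNReal.ofReal (2 * (4 / 9) + (1 - r ^ 2) / 9) := by
        rw [ENNReal.ofReal_add (by norm_num) hr2, ENNReal.ofReal_mul zero_le_two]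
        simp
    _ ≤ 1 := ENNReal.ofReal_le_one.2 (by nlinarith)

theorem maclaurinCoeff_kernelFun {r : ℝ} (hr : r ∈ Set.Ioo (0 : ℝ) 1) (n : ℕ) :
    maclaurinCoeff (kernelFun r) n = ((1 - r ^ 2) / 9 * ((n + 1) * r ^ n) : ℝ) := by
  refine maclaurinCoeff_eq_of_hasSum (a := fun n => ((1 - r ^ 2) / 9 * ((n + 1) * r ^ n) : ℝ))
    (fun z hz => ?_) (differentiableOn_kernelFun hr) n
  have hz' : ‖(r : ℂ) * z‖ < 1 := by
    have : ‖z‖ < 1 := mem_ball_zero_iff.1 hz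
    rw [norm_mul, Complex.norm_real, Real.norm_of_nonneg hr.1.le]
    nlinarith [norm_nonneg z, hr.1, hr.2]
  have h := (hasSum_choose_mul_geometric_of_norm_lt_one 1 hz').mul_left
    (((1 - r ^ 2) / 9 : ℝ) : ℂ)
  rw [← div_eq_mul_one_div] at h
  refine h.congr_fun fun k => ?_
  simp only [Nat.choose_one_right]
  push_cast
  ring

/-- The factor `n + 1` in the coefficients cancels the weight, leaving a geometric series with sum
`(1 + r) / 9`. -/
theorem hardyLittlewoodOneNorm_kernelFun_le {r : ℝ} (hr : r ∈ Set.Ioo (0 : ℝ) 1) :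
    hardyLittlewoodOneNorm (kernelFun r) ≤ 1 := by
  obtain ⟨h0, h1⟩ := id hr
  have hr2 : 0 ≤ (1 - r ^ 2) / 9 := by nlinarith
  have hterm : ∀ n : ℕ, ‖maclaurinCoeff (kernelFun r) n‖ₑ * ((n : ℝ≥0∞) + 1)⁻¹ =
      ENNReal.ofReal ((1 - r ^ 2) / 9 * r ^ n) := by
    intro n
    have e : ((n : ℝ≥0∞) + 1)⁻¹ = ENNReal.ofReal ((n : ℝ) + 1)⁻¹ := by
      rw [ENNReal.ofReal_inv_of_pos (by positivity), ENNReal.ofReal_add (by positivity) zero_le_one]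
      simp
    rw [maclaurinCoeff_kernelFun hr, ← ofReal_norm, Complex.norm_real,
      Real.norm_of_nonneg (by positivity), e, ← ENNReal.ofReal_mul (by positivity)]
    congr 1
    field_simp
  have hs := (hasSum_geometric_of_lt_one h0.le h1).mul_left ((1 - r ^ 2) / 9)
  simp only [hardyLittlewoodOneNorm, hterm]
  rw [← ENNReal.ofReal_tsum_of_nonneg (fun n => by positivity) hs.summable, hs.tsum_eq]
  refine ENNReal.ofReal_le_one.2 ?_
  rw [← div_eq_mul_inv, div_le_one (by linarith)]
  nlinarith

end TestFunctions

/-! ### The lower estimate -/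

section LowerEstimate

open MeasureTheory Filter Topology

theorem hasSum_re_deriv {g : ℂ → ℂ} (hd : DifferentiableOn ℂ g unitDisc) {x : ℝ}
    (hx : x ∈ Set.Ico (0 : ℝ) 1) :
    HasSum (fun n : ℕ => ((n : ℝ) + 1) * (maclaurinCoeff g (n + 1)).re * x ^ n)
      (deriv g x).re := by
  have hxd : (x : ℂ) ∈ unitDisc := by
    simpa [unitDisc, abs_of_nonneg hx.1] using hx.2
  refine (Complex.hasSum_re (hasSum_maclaurinCoeff (hd.deriv Metric.isOpen_ball) hxd)).congr_fun
    fun n => ?_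
  rw [maclaurinCoeff_deriv, ← Complex.ofReal_pow, Complex.re_mul_ofReal]
  have : ((n : ℂ) + 1) = ((n + 1 : ℝ) : ℂ) := by push_cast; rfl
  rw [this, Complex.re_ofReal_mul]

theorem le_hInftyNorm_integralOp_kernelFun {g : ℂ → ℂ} (hd : DifferentiableOn ℂ g unitDisc)
    (hg : ∀ n, 0 ≤ (maclaurinCoeff g n).re) {y : ℝ} (hy : y ∈ Set.Ioo (0 : ℝ) 1) :
    ∃ r ∈ Set.Ioo (0 : ℝ) 1,
      ENNReal.ofReal ((deriv g y).re / 18) ≤ hInftyNorm (integralOp g (kernelFun r)) := by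
  obtain ⟨hy0, hy1⟩ := hy
  -- This is the point to the right of `y` at pseudo-hyperbolic distance `(r - y) / (1 - r y) =
  -- 1/2`. The kernel's integral over `[y, r]` is `1/9` of this distance, whence `1/18`.
  set r : ℝ := (1 + 2 * y) / (2 + y) with hr_def
  have hr1 : r < 1 := by rw [hr_def, div_lt_one (by linarith)]; linarith
  have hyr : y < r := by rw [hr_def, lt_div_iff₀ (by linarith)]; nlinarith
  have hr0 : 0 < r := hy0.trans hyr
  refine ⟨r, ⟨hr0, hr1⟩, ?_⟩
  have hrd : (r : ℂ) ∈ unitDisc := by simpa [unitDisc, abs_of_pos hr0] using hr1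
  refine le_trans ?_ (le_iSup₂_of_le (f := fun z (_ : z ∈ unitDisc) =>
    ‖integralOp g (kernelFun r) z‖ₑ) (r : ℂ) hrd le_rfl)
  rw [← ofReal_norm]
  refine ENNReal.ofReal_le_ofReal (le_trans ?_ (Complex.re_le_norm _))
  have hmem : ∀ u ∈ Set.Icc 0 r, (u : ℂ) ∈ unitDisc := fun u hu =>
    ofReal_mem_unitBall hr1 ⟨by linarith [hu.1], hu.2⟩
  have hpos : ∀ u ∈ Set.Icc 0 r, 0 < 1 - r * u := by
    intro u hu
    nlinarith [hu.1, hu.2]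
  have hr2 : 0 < (1 - r ^ 2) / 9 := by nlinarith
  set k : ℝ → ℝ := fun u => (1 - r ^ 2) / 9 / (1 - r * u) ^ 2 with hk
  have hkc : ContinuousOn k (Set.Icc 0 r) :=
    ContinuousOn.div (by fun_prop) (by fun_prop) fun u hu => pow_ne_zero 2 (hpos u hu).ne'
  have hgc : ContinuousOn (fun u : ℝ => (deriv g u).re) (Set.Icc 0 r) :=
    Complex.continuous_re.comp_continuousOn
      ((hd.deriv Metric.isOpen_ball).continuousOn.comp Complex.continuous_ofReal.continuousOn hmem)
  have hnonneg : ∀ u ∈ Set.Icc 0 r, 0 ≤ (deriv g u).re := fun u hu =>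
    (hasSum_re_deriv hd ⟨hu.1, hu.2.trans_lt hr1⟩).nonneg fun n => by
      have := hg (n + 1)
      have := hu.1
      positivity
  have hmono : ∀ u ∈ Set.Icc y r, (deriv g y).re ≤ (deriv g u).re := fun u hu =>
    hasSum_le (fun n => by
      have := hg (n + 1)
      gcongr
      exact hu.1) (hasSum_re_deriv hd ⟨hy0.le, hy1⟩)
      (hasSum_re_deriv hd ⟨hy0.le.trans hu.1, hu.2.trans_lt hr1⟩)
  have hre : (integralOp g (kernelFun r) r).re =
      ∫ u in (0 : ℝ)..r, k u * (deriv g u).re := by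
    have hc : ContinuousOn
        (fun t : ℝ => kernelFun r (t * r) * deriv g (t * r) * (r : ℂ)) (Set.uIcc 0 1) := by
      rw [Set.uIcc_of_le zero_le_one]
      exact ((continuousOn_comp_ofReal_mul
        (differentiableOn_kernelFun ⟨hr0, hr1⟩).continuousOn hrd).mul
        (continuousOn_comp_ofReal_mul (hd.deriv Metric.isOpen_ball).continuousOn hrd)).mul
        continuousOn_const
    have h1 := Complex.reCLM.intervalIntegral_comp_comm hc.intervalIntegrable (μ := volume)
    simp only [Complex.reCLM_apply] at h1
    rw [integralOp, ← h1]
    have h2 : ∀ t : ℝ, (kernelFun r (t * r) * deriv g (t * r) * (r : ℂ)).re =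
        r * (k (t * r) * (deriv g ((t * r : ℝ) : ℂ)).re) := by
      intro t
      have : kernelFun r (t * r) = (k (t * r) : ℂ) := by
        rw [kernelFun, hk]
        push_cast
        rfl
      rw [Complex.re_mul_ofReal, this, Complex.re_ofReal_mul]
      push_cast
      ring
    simp only [h2]
    rw [intervalIntegral.integral_const_mul,
      intervalIntegral.integral_comp_mul_right (fun u : ℝ => k u * (deriv g u).re) hr0.ne']
    simp [hr0.ne']
  have hkint : ∫ u in y..r, k u = 1 / 18 := by
    have hsub : Set.uIcc y r ⊆ Set.Icc 0 r := by
      rw [Set.uIcc_of_le hyr.le]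
      exact Set.Icc_subset_Icc_left hy0.le
    rw [intervalIntegral.integral_eq_sub_of_hasDerivAt
      (f := fun u => (1 - r ^ 2) / 9 / r * (1 - r * u)⁻¹) ?_ (hkc.mono hsub).intervalIntegrable]
    · have h1 : 1 - r * r ≠ 0 := by nlinarith
      have h2 : 1 - r * y ≠ 0 := (hpos y ⟨hy0.le, hyr.le⟩).ne'
      have h3 : 2 * (r - y) = 1 - r * y := by
        rw [hr_def]
        field_simp
        ring
      have h4 : (1 - r ^ 2) / 9 / r * (1 - r * r)⁻¹ - (1 - r ^ 2) / 9 / r * (1 - r * y)⁻¹ =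
          (r - y) / (9 * (1 - r * y)) := by
        rw [← sq] at h1 ⊢
        field_simp
        ring
      rw [h4, ← h3]
      have : r - y ≠ 0 := by linarith
      field_simp
      norm_num
    · intro u hu
      have hne := (hpos u (hsub hu)).ne'
      have h2 : HasDerivAt (fun u : ℝ => 1 - r * u) (-r) u := by
        simpa using ((hasDerivAt_id u).const_mul r).const_sub 1
      refine ((h2.fun_inv hne).const_mul ((1 - r ^ 2) / 9 / r)).congr_deriv ?_
      rw [hk]
      field_simp
  have hii : ∀ a b : ℝ, a ∈ Set.Icc 0 r → b ∈ Set.Icc 0 r →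
      IntervalIntegrable (fun u => k u * (deriv g u).re) volume a b := fun a b ha hb =>
    ((hkc.mul hgc).mono (Set.OrdConnected.uIcc_subset Set.ordConnected_Icc ha hb)).intervalIntegrable
  have hy' : y ∈ Set.Icc 0 r := ⟨hy0.le, hyr.le⟩
  have hrr : r ∈ Set.Icc 0 r := ⟨hr0.le, le_rfl⟩
  have h0r : (0 : ℝ) ∈ Set.Icc 0 r := ⟨le_rfl, hr0.le⟩
  rw [hre, ← intervalIntegral.integral_add_adjacent_intervals (hii 0 y h0r hy') (hii y r hy' hrr)]
  -- The integrand is non-negative, so `[0, y]` is discarded; on `[y, r]` the derivative is at least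
  -- `g'(y)`.
  have h1 : 0 ≤ ∫ u in (0 : ℝ)..y, k u * (deriv g u).re := by
    refine intervalIntegral.integral_nonneg hy0.le fun u hu => ?_
    have := hnonneg u ⟨hu.1, hu.2.trans hyr.le⟩
    rw [hk]
    positivity
  have h2 : ∫ u in y..r, k u * (deriv g y).re ≤ ∫ u in y..r, k u * (deriv g u).re := by
    refine intervalIntegral.integral_mono_on hyr.le ?_ (hii y r hy' hrr) fun u hu => ?_
    · exact ((hkc.mono (Set.OrdConnected.uIcc_subset Set.ordConnected_Icc hy'
        hrr)).intervalIntegrable).mul_const _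
    · refine mul_le_mul_of_nonneg_left (hmono u hu) ?_
      rw [hk]
      positivity
  rw [intervalIntegral.integral_mul_const, hkint] at h2
  linarith

/-- By positivity, `g'(y)` dominates each partial sum of its series, and a partial sum is continuous
at `y = 1`. No finiteness of the full sum is needed. -/
theorem derivCoeffSum_le_of_forall_deriv {g : ℂ → ℂ} (hd : DifferentiableOn ℂ g unitDisc)
    (hg : ∀ n, 0 ≤ (maclaurinCoeff g n).re) {c : ℝ} (hc : 0 ≤ c) {K : ℝ≥0∞}
    (hK : ∀ y ∈ Set.Ioo (0 : ℝ) 1, ENNReal.ofReal (c * (deriv g y).re) ≤ K) :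
    ENNReal.ofReal c * derivCoeffSum g ≤ K := by
  set b : ℕ → ℝ := fun n => ((n : ℝ) + 1) * (maclaurinCoeff g (n + 1)).re with hb
  have hb0 : ∀ n, 0 ≤ b n := fun n => mul_nonneg (by positivity) (hg _)
  rw [derivCoeffSum, ENNReal.tsum_eq_iSup_nat, ENNReal.mul_iSup]
  refine iSup_le fun N => ?_
  rw [← ENNReal.ofReal_sum_of_nonneg fun n _ => hb0 n, ← ENNReal.ofReal_mul hc]
  have hcont : Continuous fun y : ℝ => ENNReal.ofReal (c * ∑ n ∈ Finset.range N, b n * y ^ n) :=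
    ENNReal.continuous_ofReal.comp (by fun_prop)
  have hlim : Tendsto (fun y : ℝ => ENNReal.ofReal (c * ∑ n ∈ Finset.range N, b n * y ^ n))
      (𝓝[<] 1) (𝓝 (ENNReal.ofReal (c * ∑ n ∈ Finset.range N, b n))) := by
    have := (hcont.tendsto 1).mono_left (nhdsWithin_le_nhds (s := Set.Iio 1))
    simpa using this
  refine le_of_tendsto hlim ?_
  filter_upwards [Ioo_mem_nhdsLT (show (0 : ℝ) < 1 by norm_num)] with y hy
  refine le_trans (ENNReal.ofReal_le_ofReal ?_) (hK y hy)
  refine mul_le_mul_of_nonneg_left ?_ hc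
  exact sum_le_hasSum _ (fun n _ => mul_nonneg (hb0 n) (pow_nonneg hy.1.le n))
    (hasSum_re_deriv hd ⟨hy.1.le, hy.2⟩)

end LowerEstimate

/-- Only two properties of the space enter: its norm controls radial integrals, and its unit ball
contains the test kernels. -/
theorem integralOp_estimates {N : (ℂ → ℂ) → ℝ≥0∞}
    (hupper : ∀ f, DifferentiableOn ℂ f unitDisc → ∀ z ∈ unitDisc,
      ‖z‖ₑ * ∫⁻ t in Set.Ioc (0 : ℝ) 1, ‖f (t * z)‖ₑ ≤ ENNReal.ofReal Real.pi * N f)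
    (hlower : ∀ r ∈ Set.Ioo (0 : ℝ) 1, N (kernelFun r) ≤ 1)
    {g : ℂ → ℂ} (hd : DifferentiableOn ℂ g unitDisc)
    (hg : ∀ n, 0 ≤ (maclaurinCoeff g n).re ∧ (maclaurinCoeff g n).im = 0) :
    (IsBoundedIntegralOp N g ↔ coeffSup g < ∞) ∧
      ENNReal.ofReal (1 / 18) * coeffSup g ≤ integralOpNorm N g ∧
      integralOpNorm N g ≤ ENNReal.ofReal Real.pi * coeffSup g := by
  rw [coeffSup_eq_derivCoeffSum fun n => (hg n).1]
  have hlow : ENNReal.ofReal (1 / 18) * derivCoeffSum g ≤ integralOpNorm N g := by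
    refine derivCoeffSum_le_of_forall_deriv hd (fun n => (hg n).1) (by norm_num) fun y hy => ?_
    obtain ⟨r, hr, h⟩ := le_hInftyNorm_integralOp_kernelFun hd (fun n => (hg n).1) hy
    rw [one_div_mul_eq_div]
    refine h.trans ?_
    exact le_iSup₂_of_le (f := fun f (_ : f ∈ {f | f ∈ analyticSpace N ∧ N f ≤ 1}) =>
      hInftyNorm (integralOp g f)) (kernelFun r)
      ⟨⟨differentiableOn_kernelFun hr, (hlower r hr).trans_lt ENNReal.one_lt_top⟩, hlower r hr⟩
      le_rfl
  have hup : derivCoeffSum g ≠ ∞ → ∀ f, DifferentiableOn ℂ f unitDisc →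
      hInftyNorm (integralOp g f) ≤ ENNReal.ofReal Real.pi * derivCoeffSum g * N f := by
    intro hS f hf
    refine iSup₂_le fun z hz => ?_
    refine (enorm_integralOp_le hd hg hz (hupper f hf z hz) hS).trans_eq ?_
    ring
  refine ⟨⟨?_, ?_⟩, hlow, ?_⟩
  · rintro ⟨C, hC⟩
    have hle : integralOpNorm N g ≤ C := iSup₂_le fun f hf =>
      (hC f hf.1).2.trans (mul_le_of_le_one_right zero_le hf.2)
    by_contra h
    rw [not_lt, top_le_iff] at h
    rw [h, ENNReal.mul_top (by simp)] at hlow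
    exact absurd (hlow.trans hle) (by simp)
  · intro hS
    refine ⟨(ENNReal.ofReal Real.pi * derivCoeffSum g).toNNReal, fun f hf => ?_⟩
    have hfin : ENNReal.ofReal Real.pi * derivCoeffSum g ≠ ∞ :=
      ENNReal.mul_ne_top ENNReal.ofReal_ne_top hS.ne
    rw [ENNReal.coe_toNNReal hfin]
    have h := hup hS.ne f hf.1
    exact ⟨⟨differentiableOn_integralOp hf.1 hd,
      h.trans_lt (ENNReal.mul_lt_top hfin.lt_top hf.2)⟩, h⟩
  -- If the coefficient sum is infinite, so is the right-hand side, and the bound is trivial.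
  · rcases eq_or_ne (derivCoeffSum g) ∞ with hS | hS
    · rw [hS, ENNReal.mul_top (by simpa using Real.pi_pos)]
      exact le_top
    · exact iSup₂_le fun f hf => (hup hS f hf.1.1).trans (mul_le_of_le_one_right zero_le hf.2)

theorem theorem3 :
    ∃ c C : ℝ≥0, 0 < c ∧ 0 < C ∧
      ∀ N ∈ ({hardyOneNorm, dirichletOneNorm, hardyLittlewoodOneNorm} :
          Set ((ℂ → ℂ) → ℝ≥0∞)),
        ∀ g ∈ analyticSpace hInftyNorm,
          (∀ n : ℕ, 0 ≤ (maclaurinCoeff g n).re ∧ (maclaurinCoeff g n).im = 0) →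
            (IsBoundedIntegralOp N g ↔ coeffSup g < ∞) ∧
              (c : ℝ≥0∞) * coeffSup g ≤ integralOpNorm N g ∧
              integralOpNorm N g ≤ (C : ℝ≥0∞) * coeffSup g := by
  refine ⟨Real.toNNReal (1 / 18), Real.toNNReal Real.pi, by simp, by simpa using Real.pi_pos, ?_⟩
  rintro N (rfl | rfl | rfl) g ⟨hd, -⟩ hg
  · exact integralOp_estimates (fun f hf z hz => radius_le_hardyOneNorm hf hz)
      (fun r hr => hardyOneNorm_kernelFun_le hr) hd hg
  · exact integralOp_estimates (fun f hf z hz => radius_le_dirichletOneNorm hf hz)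
      (fun r hr => dirichletOneNorm_kernelFun_le hr) hd hg
  · exact integralOp_estimates (fun f hf z hz => radius_le_hardyLittlewoodOneNorm hf hz)
      (fun r hr => hardyLittlewoodOneNorm_kernelFun_le hr) hd hg
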